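/- **Setting.** Let $(M,g)$ be a compact smooth Riemannian manifold without boundary of dimension $d\ge 1$, with Riemannian measure $dV$, isometrically embedded in $\mathbb R^D$ by a smooth embedding $\iota$. Let $K:[0,\infty)\to[0,\infty)$ be $C^3$ with $K(0)>0$, exponentially decaying ($K(t)\le Ae^{-ct}$ for some $A$ and some $c>0$) and normalized by $\int_{\mathbb R^d}K(\|x\|)\,dx=1$; put $K_\epsilon(x,y)=K(\|\iota(x)-\iota(y)\|/\sqrt\epsilon)$. Let $p_X,p_Y\in C^4(M)$ be everywhere positive probability densities with respect to $dV$. Let $x_1,x_2,\dots$ (with law $p_X\,dV$) and $y_1,y_2,\dots$ (with law $p_Y\,dV$) be random points of $M$, all of them mutually independent. For $n,m\ge1$ and $\epsilon>0$ let $W^{(r)}\in\mathbb R^{n\times m}$ be the matrix $W^{(r)}_{ik}=K_\epsilon(x_i,y_k)$, let $W^{(R)}=W^{(r)}(W^{(r)})^\top$, and let $D^{(R)}$ be the diagonal matrix with $D^{(R)}_{ii}=\sum_{j=1}^n W^{(R)}_{ij}$. For $f\in C(M)$ put $$T_{\mathrm{ref},\epsilon}f(x)=\int_M\frac{K_{\mathrm{ref},\epsilon}(x,y)}{d_{\mathrm{ref},\epsilon}(x)}f(y)p_X(y)\,dV(y),$$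 where $$K_{\mathrm{ref},\epsilon}(x,y)=\int_M K_\epsilon(x,z)K_\epsilon(z,y)p_Y(z)\,dV(z),\qquad d_{\mathrm{ref},\epsilon}(x)=\int_M K_{\mathrm{ref},\epsilon}(x,y)p_X(y)\,dV(y).$$ **Theorem (Variance analysis).** Let $f\in C(M)$; if $d=1$, assume moreover that $f\in C^1(M)$. There is a constant $C>0$, depending only on $(M,g)$, $\iota$, $K$, $p_X$, $p_Y$ and $f$, such that the following holds. Let $0<\beta\le1$, let $m=[n^\beta]$ be the integer nearest to $n^\beta$, and let $\epsilon=\epsilon(n)>0$ satisfy $\epsilon\to0$ and $\dfrac{\sqrt{\log n}}{n^{\beta/2}\epsilon^{d/2+1/2}}\to0$ as $n\to\infty$. Then for all sufficiently large $n$, with probability at least $1-C/n^2$, we have for all $i=1,\dots,n$ simultaneously that $D^{(R)}_{ii}>0$ and $$\Big|\big[(I-(D^{(R)})^{-1}W^{(R)})\boldsymbol f\big](i)-\big(f(x_i)-T_{\mathrm{ref},\epsilon}f(x_i)\big)\Big|\le C\,\frac{\sqrt{\log n}}{n^{\beta/2}\epsilon^{d/2-1/2}},$$ where $\boldsymbol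 f=(f(x_1),\dots,f(x_n))^\top$. -/

import Mathlib

open MeasureTheory ProbabilityTheory Filter Topology Manifold
open scoped ContDiff Matrix

namespace Roseland

/-- Kernel functions on `[0, ∞)` in dimension `d` (only the values `K t` with `0 ≤ t` matter):
non-negative, three times continuously differentiable, positive at `0`, exponentially decaying,
and normalized so that `∫_{ℝ^d} K(‖x‖) dx = 1`. -/
structure IsKernel (d : ℕ) (K : ℝ → ℝ) : Prop where
  nonneg : ∀ t : ℝ, 0 ≤ t → 0 ≤ K t
  contDiffOn : ContDiffOn ℝ 3 K (Set.Ici 0)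
  pos_zero : 0 < K 0
  decay : ∃ A c : ℝ, 0 < c ∧ ∀ t : ℝ, 0 ≤ t → K t ≤ A * Real.exp (-(c * t))
  normalized : ∫ x : EuclideanSpace ℝ (Fin d), K ‖x‖ = 1

section Manifold

variable {d D : ℕ} {M : Type*} [TopologicalSpace M] [ChartedSpace (EuclideanSpace ℝ (Fin d)) M]
  [IsManifold (𝓡 d) ∞ M]

/-- Smooth Riemannian metrics on the `d`-dimensional smooth manifold `M` (without boundary). -/
abbrev Metric (d : ℕ) (M : Type*) [TopologicalSpace M]
    [ChartedSpace (EuclideanSpace ℝ (Fin d)) M] [IsManifold (𝓡 d) ∞ M] :=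
  Bundle.ContMDiffRiemannianMetric (𝓡 d) ∞ (EuclideanSpace ℝ (Fin d))
    (fun x : M => TangentSpace (𝓡 d) x)

/-- `ι` is a smooth embedding of `M` into `ℝ^D` which pulls the Euclidean metric back to `g`. -/
structure IsIsometricEmbedding (g : Metric d M) (ι : M → EuclideanSpace ℝ (Fin D)) : Prop where
  contMDiff : ContMDiff (𝓡 d) (𝓡 D) ∞ ι
  isEmbedding : IsEmbedding ι
  inner_eq : ∀ (x : M) (v w : TangentSpace (𝓡 d) x),
    inner ℝ (E := EuclideanSpace ℝ (Fin D)) (mfderiv (𝓡 d) (𝓡 D) ι x v)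
      (mfderiv (𝓡 d) (𝓡 D) ι x w) = g.inner x v w

/-- The matrix `g_{ab}(u) = g(∂_a, ∂_b)` of the metric in the chart `φ` around `x`, at the point
of coordinates `u`, where `∂_a = d(φ⁻¹)_u (e_a)`. -/
noncomputable def gram (g : Metric d M) (x : M) (u : EuclideanSpace ℝ (Fin d)) :
    Matrix (Fin d) (Fin d) ℝ :=
  Matrix.of fun a b =>
    g.inner ((chartAt (EuclideanSpace ℝ (Fin d)) x).symm u)
      (mfderiv (𝓡 d) (𝓡 d) (chartAt (EuclideanSpace ℝ (Fin d)) x).symm u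
        (EuclideanSpace.single a (1 : ℝ)))
      (mfderiv (𝓡 d) (𝓡 d) (chartAt (EuclideanSpace ℝ (Fin d)) x).symm u
        (EuclideanSpace.single b (1 : ℝ)))

/-- The Riemannian measure on the domain of the chart `φ` around `x`, extended by zero:
`A ↦ ∫_{φ(A)} √(det g_{ab}(u)) du`. -/
noncomputable def chartVolume [MeasurableSpace M] (g : Metric d M) (x : M) : Measure M :=
  Measure.map (chartAt (EuclideanSpace ℝ (Fin d)) x).symm
    ((volume.restrict (chartAt (EuclideanSpace ℝ (Fin d)) x).target).withDensity
      fun u => ENNReal.ofReal (Real.sqrt (gram g x u).det))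

/-- The Riemannian measure `dV`. The measures of the charts agree on overlaps; their least upper
bound is the measure obtained by gluing them (countably many charts cover a compact `M`). -/
noncomputable def riemannianMeasure [MeasurableSpace M] (g : Metric d M) : Measure M :=
  ⨆ x : M, chartVolume g x

end Manifold

section Operators

variable {D : ℕ} {M : Type*}

/-- `K_ε(x, y) = K(‖ι x - ι y‖ / √ε)`. -/
noncomputable def kernel (ι : M → EuclideanSpace ℝ (Fin D)) (K : ℝ → ℝ) (ε : ℝ) (x y : M) : ℝ :=
  K (‖ι x - ι y‖ / Real.sqrt ε)

/-- The landmark-set affinity matrix `W^(r)`, of size `n × m`. -/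
noncomputable def landmarkSetMatrix (ι : M → EuclideanSpace ℝ (Fin D)) (K : ℝ → ℝ) (ε : ℝ)
    {n m : ℕ} (x : Fin n → M) (y : Fin m → M) : Matrix (Fin n) (Fin m) ℝ :=
  Matrix.of fun i k => kernel ι K ε (x i) (y k)

/-- The landmark-affinity matrix `W^(R) = W^(r) (W^(r))ᵀ`. -/
noncomputable def affinityMatrix (ι : M → EuclideanSpace ℝ (Fin D)) (K : ℝ → ℝ) (ε : ℝ)
    {n m : ℕ} (x : Fin n → M) (y : Fin m → M) : Matrix (Fin n) (Fin n) ℝ :=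
  landmarkSetMatrix ι K ε x y * (landmarkSetMatrix ι K ε x y)ᵀ

/-- The diagonal degree matrix `D^(R)`, with `D^(R)_ii = e_iᵀ W^(r) (W^(r))ᵀ 1`. -/
noncomputable def degreeMatrix (ι : M → EuclideanSpace ℝ (Fin D)) (K : ℝ → ℝ) (ε : ℝ)
    {n m : ℕ} (x : Fin n → M) (y : Fin m → M) : Matrix (Fin n) (Fin n) ℝ :=
  Matrix.diagonal (affinityMatrix ι K ε x y *ᵥ fun _ => 1)

variable [MeasurableSpace M]

/-- The landmark-kernel `K_{ref,ε}(x, y) = ∫_M K_ε(x, z) K_ε(z, y) p_Y(z) dV(z)`. -/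
noncomputable def refKernel (V : Measure M) (ι : M → EuclideanSpace ℝ (Fin D)) (K : ℝ → ℝ)
    (pY : M → ℝ) (ε : ℝ) (x y : M) : ℝ :=
  ∫ z, kernel ι K ε x z * kernel ι K ε z y * pY z ∂V

/-- The degree function `d_{ref,ε}(x) = ∫_M K_{ref,ε}(x, y) p_X(y) dV(y)`. -/
noncomputable def refDegree (V : Measure M) (ι : M → EuclideanSpace ℝ (Fin D)) (K : ℝ → ℝ)
    (pX pY : M → ℝ) (ε : ℝ) (x : M) : ℝ :=
  ∫ y, refKernel V ι K pY ε x y * pX y ∂V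

/-- `T_{ref,ε} f(x) = ∫_M (K_{ref,ε}(x, y) / d_{ref,ε}(x)) f(y) p_X(y) dV(y)`. -/
noncomputable def refOperator (V : Measure M) (ι : M → EuclideanSpace ℝ (Fin D)) (K : ℝ → ℝ)
    (pX pY : M → ℝ) (ε : ℝ) (f : M → ℝ) (x : M) : ℝ :=
  ∫ y, refKernel V ι K pY ε x y / refDegree V ι K pX pY ε x * f y * pX y ∂V

/-- The number of landmarks `m = [n^β]`, where `[·]` is the nearest integer. -/
noncomputable def numLandmarks (β : ℝ) (n : ℕ) : ℕ := (round ((n : ℝ) ^ β)).toNat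

end Operators

end Roseland

/-! Write k for K_ε, h = ε^(d/2), L = log n and z = x_i. Then (D⁻¹W f)(i) - f(z) is a ratio N'/Q',
where Q' averages k(z, y_l) k(y_l, x_j) over j and l, and N' averages the same products times f(x_j)
- f(z). Its population counterpart is T_ref f(z) - f(z) = N/Q, by Fubini (`integral_ratio_sub_eq`).

The double sum is not a sum of independent terms, but the landmarks decouple it. For each landmark
y_l, the inner average over the x_j is an i.i.d. average independent of y_l, and it is replaced by
its mean `massMean` or `oscMean`. What remains is an i.i.d. average over the y_l, independent of z.
Since the inner averages are centred at landmarks, the term j = i needs no separate treatment. For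
the same reason f(x_j) - f(z) is split as (f(x_j) - f(y_l)) + (f(y_l) - f(z)).

Up to explicit factors, every summand is dominated by an exponential envelope H ≤ 1 with integral
O(h), so its variance is O(h), and the Bernstein bound `measure_sum_ge_le_exp` gives deviations of
order θ = √(hL/m) off an event of probability 2/n³. Five families of at most n such events cost
10/n². On the remaining event N = O(bh²), Q ≥ a²h², and the errors in N', Q' are O(bhθ), O(hθ);
hence the ratio is off by O(bθ/h) (`abs_ratio_sub_le`). Here b measures the oscillation of f at the
scale of k, and the rate hypothesis makes θ/h small enough to keep Q' positive.

Finally θ/h is of order √L / (n^(β/2) ε^(d/4)). For d ≥ 2 boundedness of f (b = 1) suffices, because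
d/4 ≤ (d-1)/2 and ε ≤ 1. For d = 1 this fails, and the C¹ hypothesis supplies b = √ε.

The geometry enters through two facts: extrinsic balls of radius r have volume comparable to r^d
(`exists_riemannianMeasure_ball_le`, `exists_le_riemannianMeasure_ball`), and C¹ functions are
Lipschitz for the extrinsic distance. -/

namespace Roseland

/-! ### Local geometry of an isometric embedding in charts -/

section Geometry

variable {d D : ℕ} {M : Type*} [TopologicalSpace M] [ChartedSpace (EuclideanSpace ℝ (Fin d)) M]

/-- The embedding `ι` read in the chart around `x`. -/
noncomputable def coordMap (ι : M → EuclideanSpace ℝ (Fin D)) (x : M)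
    (u : EuclideanSpace ℝ (Fin d)) : EuclideanSpace ℝ (Fin D) :=
  ι ((chartAt (EuclideanSpace ℝ (Fin d)) x).symm u)

variable [IsManifold (𝓡 d) ∞ M]

theorem contDiffOn_coord {E : Type*} [NormedAddCommGroup E] [NormedSpace ℝ E] {n : ℕ∞}
    {f : M → E} (hf : ContMDiff (𝓡 d) 𝓘(ℝ, E) n f) (x : M) :
    ContDiffOn ℝ n (fun u => f ((chartAt (EuclideanSpace ℝ (Fin d)) x).symm u))
      (chartAt (EuclideanSpace ℝ (Fin d)) x).target := by
  rw [← contMDiffOn_iff_contDiffOn]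
  have h1 : ContMDiffOn (𝓡 d) (𝓡 d) n (chartAt (EuclideanSpace ℝ (Fin d)) x).symm
      (chartAt (EuclideanSpace ℝ (Fin d)) x).target :=
    (contMDiffOn_chart_symm (I := 𝓡 d) (n := ∞)).of_le (by exact_mod_cast le_top)
  exact hf.comp_contMDiffOn h1

theorem mfderiv_chart_symm_injective (x : M) {u : EuclideanSpace ℝ (Fin d)}
    (hu : u ∈ (chartAt (EuclideanSpace ℝ (Fin d)) x).target) :
    Function.Injective
      (mfderiv (𝓡 d) (𝓡 d) (chartAt (EuclideanSpace ℝ (Fin d)) x).symm u) := by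
  have : IsManifold (𝓡 d) 1 M := IsManifold.of_le (n := ∞) (by exact_mod_cast le_top)
  have h := (mdifferentiable_chart (I := 𝓡 d) x).comp_symm_deriv hu
  intro v w hvw
  have := congrArg (fun T => T v) h
  have h2 := congrArg (fun T => T w) h
  simp only [ContinuousLinearMap.comp_apply] at this h2
  rw [hvw] at this
  exact this.symm.trans h2

variable {g : Metric d M} {ι : M → EuclideanSpace ℝ (Fin D)}

theorem contDiffOn_coordMap (hι : IsIsometricEmbedding g ι) (x : M) :
    ContDiffOn ℝ ∞ (coordMap ι x) (chartAt (EuclideanSpace ℝ (Fin d)) x).target :=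
  contDiffOn_coord (n := ⊤) hι.contMDiff x

theorem contDiffAt_coordMap (hι : IsIsometricEmbedding g ι) (x : M)
    {u : EuclideanSpace ℝ (Fin d)}
    (hu : u ∈ (chartAt (EuclideanSpace ℝ (Fin d)) x).target) :
    ContDiffAt ℝ ∞ (coordMap ι x) u :=
  (contDiffOn_coordMap hι x).contDiffAt
    ((chartAt (EuclideanSpace ℝ (Fin d)) x).open_target.mem_nhds hu)

theorem fderiv_coordMap (hι : IsIsometricEmbedding g ι) (x : M)
    {u : EuclideanSpace ℝ (Fin d)}
    (hu : u ∈ (chartAt (EuclideanSpace ℝ (Fin d)) x).target)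
    (v : EuclideanSpace ℝ (Fin d)) :
    fderiv ℝ (coordMap ι x) u v =
      mfderiv (𝓡 d) (𝓡 D) ι ((chartAt (EuclideanSpace ℝ (Fin d)) x).symm u)
        (mfderiv (𝓡 d) (𝓡 d) (chartAt (EuclideanSpace ℝ (Fin d)) x).symm u v) := by
  have : IsManifold (𝓡 d) 1 M := IsManifold.of_le (n := ∞) (by exact_mod_cast le_top)
  have h1 : MDifferentiableAt (𝓡 d) (𝓡 D) ι
      ((chartAt (EuclideanSpace ℝ (Fin d)) x).symm u) :=
    hι.contMDiff.mdifferentiableAt (by simp)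
  have h2 : MDifferentiableAt (𝓡 d) (𝓡 d) (chartAt (EuclideanSpace ℝ (Fin d)) x).symm u :=
    (mdifferentiable_chart (I := 𝓡 d) x).mdifferentiableAt_symm hu
  have h3 := mfderiv_comp u h1 h2
  rw [mfderiv_eq_fderiv] at h3
  exact congrArg (fun T => T v) h3

theorem inner_fderiv_coordMap (hι : IsIsometricEmbedding g ι) (x : M)
    {u : EuclideanSpace ℝ (Fin d)}
    (hu : u ∈ (chartAt (EuclideanSpace ℝ (Fin d)) x).target)
    (v w : EuclideanSpace ℝ (Fin d)) :
    inner ℝ (fderiv ℝ (coordMap ι x) u v) (fderiv ℝ (coordMap ι x) u w) =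
      g.inner ((chartAt (EuclideanSpace ℝ (Fin d)) x).symm u)
        (mfderiv (𝓡 d) (𝓡 d) (chartAt (EuclideanSpace ℝ (Fin d)) x).symm u v)
        (mfderiv (𝓡 d) (𝓡 d) (chartAt (EuclideanSpace ℝ (Fin d)) x).symm u w) := by
  rw [fderiv_coordMap hι x hu, fderiv_coordMap hι x hu]
  exact hι.inner_eq _ _ _

/-- The pulled-back metric is positive definite, so a vector of the kernel would have zero length.
-/
theorem fderiv_coordMap_injective (hι : IsIsometricEmbedding g ι) (x : M)
    {u : EuclideanSpace ℝ (Fin d)}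
    (hu : u ∈ (chartAt (EuclideanSpace ℝ (Fin d)) x).target) :
    Function.Injective (fderiv ℝ (coordMap ι x) u) := by
  rw [injective_iff_map_eq_zero]
  intro v hv
  have h := inner_fderiv_coordMap hι x hu v v
  rw [hv, inner_zero_left] at h
  apply mfderiv_chart_symm_injective x hu
  refine Eq.trans ?_ (map_zero _).symm
  by_contra hne
  exact (g.pos _ _ hne).ne h

/-- The Gram determinant of `A`. -/
noncomputable def gramDet (A : EuclideanSpace ℝ (Fin d) →L[ℝ] EuclideanSpace ℝ (Fin D)) : ℝ :=
  (Matrix.gram ℝ fun a : Fin d => A (EuclideanSpace.single a (1 : ℝ))).det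

theorem det_gram (hι : IsIsometricEmbedding g ι) (x : M)
    {u : EuclideanSpace ℝ (Fin d)}
    (hu : u ∈ (chartAt (EuclideanSpace ℝ (Fin d)) x).target) :
    (gram g x u).det = gramDet (fderiv ℝ (coordMap ι x) u) := by
  unfold gramDet
  congr 1
  ext a b
  simp only [gram, Matrix.of_apply, Matrix.gram_apply]
  exact (inner_fderiv_coordMap hι x hu _ _).symm

theorem gram_eq_transpose_mul
    (A : EuclideanSpace ℝ (Fin d) →L[ℝ] EuclideanSpace ℝ (Fin D)) :
    (Matrix.gram ℝ fun a : Fin d => A (EuclideanSpace.single a (1 : ℝ))) =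
      (LinearMap.toMatrix (EuclideanSpace.basisFun (Fin d) ℝ).toBasis
        (EuclideanSpace.basisFun (Fin D) ℝ).toBasis (A : _ →ₗ[ℝ] _))ᵀ *
      LinearMap.toMatrix (EuclideanSpace.basisFun (Fin d) ℝ).toBasis
        (EuclideanSpace.basisFun (Fin D) ℝ).toBasis (A : _ →ₗ[ℝ] _) := by
  ext a b
  simp [Matrix.gram_apply, Matrix.mul_apply, LinearMap.toMatrix_apply, PiLp.inner_apply, mul_comm]

/-- The Gram matrix is AᵀA, so J contributes det J twice. After a square root this is the Jacobian
factor that makes the Riemannian densities of two charts agree. -/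
theorem gramDet_comp (A : EuclideanSpace ℝ (Fin d) →L[ℝ] EuclideanSpace ℝ (Fin D))
    (J : EuclideanSpace ℝ (Fin d) →L[ℝ] EuclideanSpace ℝ (Fin d)) :
    gramDet (A.comp J) = J.det ^ 2 * gramDet A := by
  have hJ : J.det = (LinearMap.toMatrix (EuclideanSpace.basisFun (Fin d) ℝ).toBasis
      (EuclideanSpace.basisFun (Fin d) ℝ).toBasis (J : _ →ₗ[ℝ] _)).det :=
    (LinearMap.det_toMatrix _ _).symm
  rw [gramDet, gramDet, gram_eq_transpose_mul, gram_eq_transpose_mul,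
    ContinuousLinearMap.toLinearMap_comp,
    LinearMap.toMatrix_comp _ (EuclideanSpace.basisFun (Fin d) ℝ).toBasis, hJ,
    Matrix.transpose_mul, Matrix.mul_assoc, ← Matrix.mul_assoc _ _ (LinearMap.toMatrix _ _ _),
    Matrix.det_mul, Matrix.det_mul, Matrix.det_transpose]
  ring

theorem gramDet_pos {A : EuclideanSpace ℝ (Fin d) →L[ℝ] EuclideanSpace ℝ (Fin D)}
    (hA : Function.Injective A) : 0 < gramDet A := by
  apply Matrix.PosDef.det_pos
  apply Matrix.posDef_gram_of_linearIndependent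
  have h := (EuclideanSpace.basisFun (Fin d) ℝ).toBasis.linearIndependent.map'
    A.toLinearMap (LinearMap.ker_eq_bot.2 hA)
  have h2 : (fun a : Fin d => A (EuclideanSpace.single a (1 : ℝ))) =
      ⇑A.toLinearMap ∘ ⇑(EuclideanSpace.basisFun (Fin d) ℝ).toBasis := by
    ext a : 1
    simp
  rw [h2]
  exact h

theorem continuous_gramDet : Continuous
    (gramDet : (EuclideanSpace ℝ (Fin d) →L[ℝ] EuclideanSpace ℝ (Fin D)) → ℝ) := by
  unfold gramDet
  apply Continuous.matrix_det
  refine continuous_matrix fun a b => ?_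
  simp only [Matrix.gram_apply]
  fun_prop

/-- The local picture of an isometric embedding in a chart: bi-Lipschitz, with volume density
bounded above and below. -/
theorem exists_ball_coordMap (hι : IsIsometricEmbedding g ι) (x : M) :
    ∃ ρ c₁ c₂ : ℝ, 0 < ρ ∧ 0 < c₁ ∧ 0 < c₂ ∧
      Metric.ball (chartAt (EuclideanSpace ℝ (Fin d)) x x) (2 * ρ) ⊆
        (chartAt (EuclideanSpace ℝ (Fin d)) x).target ∧
      (∀ u ∈ Metric.ball (chartAt (EuclideanSpace ℝ (Fin d)) x x) (2 * ρ),
        ∀ v ∈ Metric.ball (chartAt (EuclideanSpace ℝ (Fin d)) x x) (2 * ρ),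
          c₁ * ‖u - v‖ ≤ ‖coordMap ι x u - coordMap ι x v‖ ∧
          ‖coordMap ι x u - coordMap ι x v‖ ≤ c₂ * ‖u - v‖) ∧
      ∀ u ∈ Metric.ball (chartAt (EuclideanSpace ℝ (Fin d)) x x) (2 * ρ),
        c₁ ≤ Real.sqrt (gram g x u).det ∧ Real.sqrt (gram g x u).det ≤ c₂ := by
  set φ := chartAt (EuclideanSpace ℝ (Fin d)) x
  set u₀ := φ x
  have hu₀ : u₀ ∈ φ.target := mem_chart_target _ x
  set A := fderiv ℝ (coordMap ι x) u₀ with hAdef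
  have hinj := fderiv_coordMap_injective hι x hu₀
  have hcd := contDiffAt_coordMap hι x hu₀
  have hstrict : HasStrictFDerivAt (coordMap ι x) A u₀ := hcd.hasStrictFDerivAt (by simp)
  obtain ⟨κ, hκ, hanti⟩ := A.toLinearMap.exists_antilipschitzWith (LinearMap.ker_eq_bot.2 hinj)
  have hlow : ∀ w, ‖w‖ ≤ κ * ‖A w‖ := fun w => by
    have := hanti.le_mul_dist w 0
    simpa using this
  have hκ' : (0 : ℝ) < κ := hκ
  -- The derivative `A` is bounded below by 1/κ = 2a. Allowing a remainder a‖u - v‖ in strict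
  -- differentiability leaves a lower Lipschitz constant a.
  set a : ℝ := (2 * κ)⁻¹ with ha
  have ha0 : 0 < a := by positivity
  have hT : ∀ᶠ p in 𝓝 (u₀, u₀),
      ‖coordMap ι x p.1 - coordMap ι x p.2 - A (p.1 - p.2)‖ ≤ a * ‖p.1 - p.2‖ :=
    hstrict.isLittleO.def ha0
  set s₀ := Real.sqrt (gramDet A) with hs₀
  have hs₀pos : 0 < s₀ := Real.sqrt_pos.2 (gramDet_pos hinj)
  have hcont : ContinuousAt (fun u => Real.sqrt (gramDet (fderiv ℝ (coordMap ι x) u))) u₀ := by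
    have h1 : ContinuousAt (fderiv ℝ (coordMap ι x)) u₀ :=
      (hcd.fderiv_right (m := 0) (by simp)).continuousAt
    exact Real.continuous_sqrt.continuousAt.comp (continuous_gramDet.continuousAt.comp h1)
  have hD : ∀ᶠ u in 𝓝 u₀, Real.sqrt (gramDet (fderiv ℝ (coordMap ι x) u)) ∈
      Set.Ioo (s₀ / 2) (2 * s₀) :=
    hcont.eventually (Ioo_mem_nhds (by change s₀ / 2 < s₀; linarith) (by change s₀ < 2 * s₀; linarith))
  have htgt : ∀ᶠ u in 𝓝 u₀, u ∈ φ.target := φ.open_target.mem_nhds hu₀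
  rw [nhds_prod_eq] at hT
  obtain ⟨r₁, hr₁, h₁⟩ := Metric.eventually_nhds_iff_ball.1 (hD.and htgt)
  obtain ⟨t, ht, hT⟩ := Filter.eventually_prod_self_iff'.1 hT
  obtain ⟨r₂, hr₂, h₂⟩ := Metric.mem_nhds_iff.1 ht
  refine ⟨min r₁ r₂ / 2, min a (s₀ / 2), max (‖A‖ + a) (2 * s₀), by positivity, by positivity,
    by positivity, ?_, ?_, ?_⟩
  · intro u hu
    exact (h₁ u (Metric.ball_subset_ball (by linarith [min_le_left r₁ r₂]) hu)).2
  · intro u hu v hv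
    have hu' := h₂ (Metric.ball_subset_ball (by linarith [min_le_right r₁ r₂]) hu)
    have hv' := h₂ (Metric.ball_subset_ball (by linarith [min_le_right r₁ r₂]) hv)
    have h : ‖coordMap ι x u - coordMap ι x v - A (u - v)‖ ≤ a * ‖u - v‖ := hT u hu' v hv'
    have hl := hlow (u - v)
    have hl2 : 2 * a * ‖u - v‖ ≤ ‖A (u - v)‖ := by
      rw [ha, mul_inv, ← mul_assoc, mul_inv_cancel₀ two_ne_zero, one_mul, inv_mul_le_iff₀ hκ']
      exact hl
    have hop := A.le_opNorm (u - v)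
    constructor
    · have h3 := norm_sub_norm_le (A (u - v)) (coordMap ι x u - coordMap ι x v)
      rw [norm_sub_rev (A (u - v))] at h3
      calc min a (s₀ / 2) * ‖u - v‖ ≤ a * ‖u - v‖ := by gcongr; exact min_le_left _ _
        _ ≤ _ := by linarith
    · have h3 := norm_sub_norm_le (coordMap ι x u - coordMap ι x v) (A (u - v))
      calc _ ≤ (‖A‖ + a) * ‖u - v‖ := by linarith
        _ ≤ _ := by gcongr; exact le_max_left _ _
  · intro u hu
    obtain ⟨h3, h4⟩ := h₁ u (Metric.ball_subset_ball (by linarith [min_le_left r₁ r₂]) hu)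
    rw [det_gram hι x h4]
    exact ⟨(min_le_right _ _).trans h3.1.le, h3.2.le.trans (le_max_right _ _)⟩

theorem isOpen_extrinsicBall (hι : IsIsometricEmbedding g ι) (x : M) (r : ℝ) :
    IsOpen {y | ‖ι x - ι y‖ < r} :=
  isOpen_lt (by have := hι.isEmbedding.continuous; fun_prop) continuous_const

/-- The coordinate maps are bi-Lipschitz onto their images near each point, so f transported to ι(M)
is locally Lipschitz, and compactness of ι(M) makes it globally so. The distance is the extrinsic
one because the kernel sees only that one. -/
theorem exists_lipschitz_of_contMDiff [CompactSpace M] (hι : IsIsometricEmbedding g ι)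
    {f : M → ℝ} (hf : ContMDiff (𝓡 d) 𝓘(ℝ, ℝ) 1 f) :
    ∃ C : ℝ, 0 ≤ C ∧ ∀ x y : M, |f x - f y| ≤ C * ‖ι x - ι y‖ := by
  set h : EuclideanSpace ℝ (Fin D) → ℝ := Function.extend ι f 0 with hh
  have hext : ∀ x, h (ι x) = f x := fun x => hι.isEmbedding.injective.extend_apply f 0 x
  have hlip : LocallyLipschitzOn (Set.range ι) h := by
    rintro _ ⟨x, rfl⟩
    obtain ⟨ρ, c₁, c₂, hρ, hc₁, -, hsub, hlip, -⟩ := exists_ball_coordMap hι x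
    set φ := chartAt (EuclideanSpace ℝ (Fin d)) x with hφ
    have hcd : ContDiffAt ℝ 1 (fun u => f (φ.symm u)) (φ x) :=
      (contDiffOn_coord (n := 1) hf x).contDiffAt (φ.open_target.mem_nhds (mem_chart_target _ x))
    obtain ⟨L, s, hs, hL⟩ := hcd.exists_lipschitzOnWith
    have hN : φ.source ∩ φ ⁻¹' (s ∩ Metric.ball (φ x) (2 * ρ)) ∈ 𝓝 x := by
      refine Filter.inter_mem (φ.open_source.mem_nhds (mem_chart_source _ x)) ?_
      exact (φ.continuousAt (mem_chart_source _ x)).preimage_mem_nhds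
        (Filter.inter_mem hs (Metric.ball_mem_nhds _ (by positivity)))
    refine ⟨L * c₁⁻¹.toNNReal, ι '' (φ.source ∩ φ ⁻¹' (s ∩ Metric.ball (φ x) (2 * ρ))),
      ?_, ?_⟩
    · rw [← hι.isEmbedding.map_nhds_eq]
      exact Filter.image_mem_map hN
    · refine LipschitzOnWith.of_dist_le_mul ?_
      rintro _ ⟨y, hy, rfl⟩ _ ⟨z, hz, rfl⟩
      have h1 := hL.dist_le_mul _ hy.2.1 _ hz.2.1
      simp only [φ.left_inv hy.1, φ.left_inv hz.1] at h1
      have h2 := (hlip _ hy.2.2 _ hz.2.2).1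
      simp only [coordMap, ← hφ, φ.left_inv hy.1, φ.left_inv hz.1] at h2
      rw [hext, hext]
      refine h1.trans ?_
      rw [NNReal.coe_mul, mul_assoc, Real.coe_toNNReal _ (inv_pos.2 hc₁).le]
      gcongr
      rw [inv_mul_eq_div, le_div_iff₀ hc₁, dist_eq_norm, dist_eq_norm, mul_comm]
      exact h2
  obtain ⟨C, hC⟩ := hlip.exists_lipschitzOnWith_of_compact
    (isCompact_range hι.isEmbedding.continuous)
  refine ⟨C, C.2, fun x y => ?_⟩
  have := hC.dist_le_mul _ ⟨x, rfl⟩ _ ⟨y, rfl⟩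
  rwa [hext, hext, Real.dist_eq, dist_eq_norm] at this

end Geometry

/-! ### Riemannian measure: comparison of charts and volumes of extrinsic balls -/

section Volume

variable {d D : ℕ} {M : Type*} [TopologicalSpace M] [ChartedSpace (EuclideanSpace ℝ (Fin d)) M]
  [MeasurableSpace M]

theorem measurableSet_target_inter_preimage [BorelSpace M] (x : M) {A : Set M} (hA : MeasurableSet A) :
    MeasurableSet ((chartAt (EuclideanSpace ℝ (Fin d)) x).target ∩
      (chartAt (EuclideanSpace ℝ (Fin d)) x).symm ⁻¹' A) := by
  set φ := chartAt (EuclideanSpace ℝ (Fin d)) x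
  have h : Measurable (φ.target.domRestrict φ.symm) :=
    (continuousOn_iff_continuous_domRestrict.1 φ.continuousOn_symm).measurable
  have := (φ.open_target.measurableSet).subtype_image (h hA)
  convert this using 1
  ext u
  simp [Set.domRestrict, and_comm]

variable [IsManifold (𝓡 d) ∞ M]

theorem chartVolume_le_riemannianMeasure (g : Metric d M) (x : M) (A : Set M) :
    chartVolume g x A ≤ riemannianMeasure g A :=
  Measure.le_iff'.1 (le_iSup (chartVolume g) x) A

variable [BorelSpace M]
  {g : Metric d M} {ι : M → EuclideanSpace ℝ (Fin D)}

theorem chartVolume_apply (g : Metric d M) (x : M) {A : Set M} (hA : MeasurableSet A) :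
    chartVolume g x A =
      ∫⁻ u in (chartAt (EuclideanSpace ℝ (Fin d)) x).target ∩
        (chartAt (EuclideanSpace ℝ (Fin d)) x).symm ⁻¹' A,
        ENNReal.ofReal (Real.sqrt (gram g x u).det) := by
  set φ := chartAt (EuclideanSpace ℝ (Fin d)) x
  have hm : AEMeasurable φ.symm ((volume.restrict φ.target).withDensity
      fun u => ENNReal.ofReal (Real.sqrt (gram g x u).det)) :=
    (φ.continuousOn_symm.aemeasurable φ.open_target.measurableSet).mono_ac
      (withDensity_absolutelyContinuous _ _)
  rw [chartVolume, Measure.map_apply_of_aemeasurable hm hA, withDensity_apply',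
    Measure.restrict_restrict' φ.open_target.measurableSet, Set.inter_comm]

/-- Change of variables along the transition map, whose Jacobian is absorbed by `gramDet_comp`.
There is only an inequality because the chart at `x` may miss part of `A`. -/
theorem chartVolume_le_of_subset_source (hι : IsIsometricEmbedding g ι) (x x₀ : M) {A : Set M}
    (hA : MeasurableSet A) (hA₀ : A ⊆ (chartAt (EuclideanSpace ℝ (Fin d)) x₀).source) :
    chartVolume g x A ≤ chartVolume g x₀ A := by
  have : IsManifold (𝓡 d) 1 M := IsManifold.of_le (n := ∞) (by exact_mod_cast le_top)
  rw [chartVolume_apply g x hA, chartVolume_apply g x₀ hA]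
  have hmd := mdifferentiable_chart (I := 𝓡 d) x
  have hmd₀ := mdifferentiable_chart (I := 𝓡 d) x₀
  set φ := chartAt (EuclideanSpace ℝ (Fin d)) x with hφ
  set ψ := chartAt (EuclideanSpace ℝ (Fin d)) x₀ with hψ
  set S := φ.target ∩ φ.symm ⁻¹' A with hS
  set τ : EuclideanSpace ℝ (Fin d) → EuclideanSpace ℝ (Fin d) := fun u => ψ (φ.symm u) with hτ
  have hSm : MeasurableSet S := measurableSet_target_inter_preimage x hA
  have hdiff : ∀ u ∈ S, DifferentiableAt ℝ τ u := fun u hu => by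
    rw [← mdifferentiableAt_iff_differentiableAt]
    exact (hmd₀.mdifferentiableAt (hA₀ hu.2)).comp u (hmd.mdifferentiableAt_symm hu.1)
  have hinj : Set.InjOn τ S := fun u hu v hv huv =>
    φ.symm.injOn hu.1 hv.1 (ψ.injOn (hA₀ hu.2) (hA₀ hv.2) huv)
  have himg : τ '' S ⊆ ψ.target ∩ ψ.symm ⁻¹' A := by
    rintro _ ⟨u, hu, rfl⟩
    refine ⟨ψ.map_source (hA₀ hu.2), ?_⟩
    simp only [hτ, Set.mem_preimage, ψ.left_inv (hA₀ hu.2)]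
    exact hu.2
  refine le_trans (le_of_eq ?_) (lintegral_mono_set himg)
  rw [lintegral_image_eq_lintegral_abs_det_fderiv_mul volume hSm
    (fun u hu => (hdiff u hu).hasFDerivAt.hasFDerivWithinAt) hinj]
  refine setLIntegral_congr_fun hSm fun u hu => ?_
  have hτu : τ u ∈ ψ.target := (himg ⟨u, hu, rfl⟩).1
  have hloc : coordMap ι x =ᶠ[𝓝 u] coordMap ι x₀ ∘ τ := by
    have hopen : φ.target ∩ φ.symm ⁻¹' ψ.source ∈ 𝓝 u :=
      (φ.symm.isOpen_inter_preimage ψ.open_source).mem_nhds ⟨hu.1, hA₀ hu.2⟩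
    filter_upwards [hopen] with v hv
    simp only [coordMap, Function.comp_apply, hτ, ← hφ, ← hψ]
    rw [ψ.left_inv hv.2]
  have hchain : fderiv ℝ (coordMap ι x) u =
      (fderiv ℝ (coordMap ι x₀) (τ u)).comp (fderiv ℝ τ u) := by
    rw [hloc.fderiv_eq]
    exact fderiv_comp u ((contDiffAt_coordMap hι x₀ hτu).differentiableAt (by simp)) (hdiff u hu)
  rw [det_gram hι x hu.1, det_gram hι x₀ hτu, hchain, gramDet_comp,
    Real.sqrt_mul (sq_nonneg _), Real.sqrt_sq_eq_abs, ENNReal.ofReal_mul (abs_nonneg _)]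

/-- Cut `A` along a finite subcover: on each piece every chart volume is at most that of the chart
attached to the piece. The finite sum thus dominates every chart volume, hence their supremum. -/
theorem exists_riemannianMeasure_le_sum [CompactSpace M] (hι : IsIsometricEmbedding g ι)
    {U : M → Set M}
    (hU : ∀ x, IsOpen (U x)) (hxU : ∀ x, x ∈ U x)
    (hUs : ∀ x, U x ⊆ (chartAt (EuclideanSpace ℝ (Fin d)) x).source) :
    ∃ t : Finset M, ∀ A, MeasurableSet A →
      riemannianMeasure g A ≤ ∑ x ∈ t, chartVolume g x (A ∩ U x) := by
  obtain ⟨t, ht⟩ := CompactSpace.elim_nhds_subcover U fun x => (hU x).mem_nhds (hxU x)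
  refine ⟨t, ?_⟩
  have hle : riemannianMeasure g ≤ ∑ x ∈ t, (chartVolume g x).restrict (U x) := by
    refine iSup_le fun x => Measure.le_iff.2 fun A hA => ?_
    calc chartVolume g x A ≤ chartVolume g x (⋃ y ∈ t, A ∩ U y) := by
          apply measure_mono
          rw [← Set.inter_iUnion₂, ht]
          simp
      _ ≤ ∑ y ∈ t, chartVolume g x (A ∩ U y) := measure_biUnion_finset_le _ _
      _ ≤ ∑ y ∈ t, chartVolume g y (A ∩ U y) := by
          refine Finset.sum_le_sum fun y _ => ?_
          exact chartVolume_le_of_subset_source hι x y (hA.inter (hU y).measurableSet)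
            (Set.inter_subset_right.trans (hUs y))
      _ = _ := by
          rw [Measure.finsetSum_apply]
          exact Finset.sum_congr rfl fun y _ => (Measure.restrict_apply hA).symm
  intro A hA
  refine (Measure.le_iff.1 hle A hA).trans (le_of_eq ?_)
  rw [Measure.finsetSum_apply]
  exact Finset.sum_congr rfl fun y _ => Measure.restrict_apply hA

theorem exists_riemannianMeasure_ball_le [CompactSpace M] (hι : IsIsometricEmbedding g ι) :
    ∃ C : ℝ, 0 < C ∧ ∀ (x : M) (r : ℝ), 0 < r →
      riemannianMeasure g {y | ‖ι x - ι y‖ < r} ≤ ENNReal.ofReal (C * r ^ d) := by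
  choose ρ c₁ c₂ hρ hc₁ hc₂ hsub hlip hdens using exists_ball_coordMap (ι := ι) hι
  set U : M → Set M := fun x => (chartAt (EuclideanSpace ℝ (Fin d)) x).source ∩
    chartAt (EuclideanSpace ℝ (Fin d)) x ⁻¹'
      Metric.ball (chartAt (EuclideanSpace ℝ (Fin d)) x x) (2 * ρ x) with hUdef
  obtain ⟨t, ht⟩ := exists_riemannianMeasure_le_sum (U := U) hι
    (fun x => (chartAt (EuclideanSpace ℝ (Fin d)) x).isOpen_inter_preimage Metric.isOpen_ball)
    (fun x => ⟨mem_chart_source _ x, Metric.mem_ball_self (by linarith [hρ x])⟩)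
    (fun x => Set.inter_subset_left)
  set v₁ : ℝ := volume.real (Metric.ball (0 : EuclideanSpace ℝ (Fin d)) 1) with hv₁
  have hloc : ∀ x z : M, ∀ r : ℝ, 0 < r → chartVolume g x ({y | ‖ι z - ι y‖ < r} ∩ U x) ≤
      ENNReal.ofReal (c₂ x * ((2 / c₁ x) ^ d * v₁) * r ^ d) := by
    intro x z r hr
    have hAm : MeasurableSet ({y | ‖ι z - ι y‖ < r} ∩ U x) :=
      ((isOpen_extrinsicBall hι z r).inter
        ((chartAt (EuclideanSpace ℝ (Fin d)) x).isOpen_inter_preimage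
          Metric.isOpen_ball)).measurableSet
    rw [chartVolume_apply g x hAm]
    have hSm := measurableSet_target_inter_preimage (d := d) x hAm
    set φ := chartAt (EuclideanSpace ℝ (Fin d)) x with hφ
    set S := φ.target ∩ φ.symm ⁻¹' ({y | ‖ι z - ι y‖ < r} ∩ U x) with hS
    have hSball : S ⊆ Metric.ball (φ x) (2 * ρ x) := by
      rintro u ⟨hu, -, -, hu2⟩
      rwa [Set.mem_preimage, φ.right_inv hu] at hu2
    have hvol : volume S ≤ ENNReal.ofReal ((2 / c₁ x) ^ d * v₁ * r ^ d) := by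
      rcases S.eq_empty_or_nonempty with h | ⟨v, hv⟩
      · rw [h]; simp
      -- The centre `z` may lie outside this chart, so the Euclidean ball is centred at a point of
      -- `S`; the triangle inequality costs the factor 2.
      have hsubs : S ⊆ Metric.ball v (2 * r / c₁ x) := by
        intro u hu
        have h1 := (hlip x u (hSball hu) v (hSball hv)).1
        have h2 : ‖ι z - coordMap ι x u‖ < r := hu.2.1
        have h3 : ‖ι z - coordMap ι x v‖ < r := hv.2.1
        have h4 : ‖coordMap ι x u - coordMap ι x v‖ < 2 * r := by
          calc _ = ‖(ι z - coordMap ι x v) - (ι z - coordMap ι x u)‖ := by congr 1; abel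
            _ ≤ _ := norm_sub_le _ _
            _ < _ := by linarith
        rw [mem_ball_iff_norm, lt_div_iff₀ (hc₁ x)]
        linarith
      refine (measure_mono hsubs).trans (le_of_eq ?_)
      have hR : 0 < 2 * r / c₁ x := by have := hc₁ x; positivity
      rw [Measure.addHaar_ball_of_pos _ _ hR, finrank_euclideanSpace_fin,
        ← ENNReal.ofReal_toReal (measure_ball_lt_top (x := (0 : EuclideanSpace ℝ (Fin d)))).ne,
        ← ENNReal.ofReal_mul (by positivity)]
      congr 1
      change _ * v₁ = _
      rw [div_pow, mul_pow, div_pow]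
      ring
    calc _ ≤ ∫⁻ _ in S, ENNReal.ofReal (c₂ x) :=
          setLIntegral_mono' hSm fun u hu =>
            ENNReal.ofReal_le_ofReal (hdens x u (hSball hu)).2
      _ = ENNReal.ofReal (c₂ x) * volume S := setLIntegral_const _ _
      _ ≤ _ := by
          rw [mul_assoc, ENNReal.ofReal_mul (hc₂ x).le]
          gcongr
  have hv₁0 : 0 ≤ v₁ := measureReal_nonneg
  have hnn : ∀ x, 0 ≤ c₂ x * ((2 / c₁ x) ^ d * v₁) := fun x => by
    have := hc₁ x; have := hc₂ x; positivity
  refine ⟨∑ x ∈ t, c₂ x * ((2 / c₁ x) ^ d * v₁) + 1,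
    add_pos_of_nonneg_of_pos (Finset.sum_nonneg fun x _ => hnn x) one_pos, fun z r hr => ?_⟩
  refine (ht _ (isOpen_extrinsicBall hι z r).measurableSet).trans ?_
  refine (Finset.sum_le_sum fun x _ => hloc x z r hr).trans ?_
  rw [← ENNReal.ofReal_sum_of_nonneg fun x _ => mul_nonneg (hnn x) (by positivity),
    ← Finset.sum_mul]
  refine ENNReal.ofReal_le_ofReal ?_
  gcongr
  linarith

/-- One chart suffices for a lower bound on a supremum. The covering sets use radius ρ while the
bi-Lipschitz estimate holds up to 2ρ, which leaves room for a coordinate ball of radius at most ρ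
around `z`. -/
theorem exists_le_riemannianMeasure_ball [CompactSpace M] (hι : IsIsometricEmbedding g ι) :
    ∃ c r₀ : ℝ, 0 < c ∧ 0 < r₀ ∧ ∀ (x : M) (r : ℝ), 0 < r → r ≤ r₀ →
      ENNReal.ofReal (c * r ^ d) ≤ riemannianMeasure g {y | ‖ι x - ι y‖ < r} := by
  choose ρ c₁ c₂ hρ hc₁ hc₂ hsub hlip hdens using exists_ball_coordMap (ι := ι) hι
  set U : M → Set M := fun x => (chartAt (EuclideanSpace ℝ (Fin d)) x).source ∩
    chartAt (EuclideanSpace ℝ (Fin d)) x ⁻¹'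
      Metric.ball (chartAt (EuclideanSpace ℝ (Fin d)) x x) (ρ x) with hUdef
  obtain ⟨t, ht⟩ := CompactSpace.elim_nhds_subcover U fun x =>
    ((chartAt (EuclideanSpace ℝ (Fin d)) x).isOpen_inter_preimage Metric.isOpen_ball).mem_nhds
      ⟨mem_chart_source _ x, Metric.mem_ball_self (hρ x)⟩
  set v₁ : ℝ := volume.real (Metric.ball (0 : EuclideanSpace ℝ (Fin d)) 1) with hv₁
  have hv₁0 : 0 < v₁ :=
    ENNReal.toReal_pos (Metric.measure_ball_pos _ _ one_pos).ne' measure_ball_lt_top.ne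
  have hloc : ∀ x z : M, z ∈ U x → ∀ r : ℝ, 0 < r → r ≤ c₂ x * ρ x →
      ENNReal.ofReal (c₁ x * ((1 / c₂ x) ^ d * v₁) * r ^ d) ≤
        riemannianMeasure g {y | ‖ι z - ι y‖ < r} := by
    intro x z hz r hr hrρ
    refine le_trans ?_ (chartVolume_le_riemannianMeasure g x _)
    have hAm := (isOpen_extrinsicBall hι z r).measurableSet
    rw [chartVolume_apply g x hAm]
    set φ := chartAt (EuclideanSpace ℝ (Fin d)) x with hφ
    have hR : 0 < r / c₂ x := by have := hc₂ x; positivity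
    have hRρ : r / c₂ x ≤ ρ x := by rw [div_le_iff₀ (hc₂ x)]; linarith
    have hB : Metric.ball (φ z) (r / c₂ x) ⊆ Metric.ball (φ x) (2 * ρ x) := by
      apply Metric.ball_subset_ball'
      have : dist (φ z) (φ x) < ρ x := hz.2
      linarith
    have hBS : Metric.ball (φ z) (r / c₂ x) ⊆ φ.target ∩ φ.symm ⁻¹' {y | ‖ι z - ι y‖ < r} := by
      intro u hu
      refine ⟨hsub x (hB hu), ?_⟩
      have h1 := (hlip x (φ z) (hB (Metric.mem_ball_self hR)) u (hB hu)).2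
      have h2 : coordMap ι x (φ z) = ι z := by
        unfold coordMap
        rw [φ.left_inv hz.1]
      rw [h2] at h1
      have h3 : ‖φ z - u‖ < r / c₂ x := by rw [norm_sub_rev]; exact mem_ball_iff_norm.1 hu
      rw [lt_div_iff₀ (hc₂ x)] at h3
      change ‖ι z - coordMap ι x u‖ < r
      linarith
    calc _ = ENNReal.ofReal (c₁ x) * volume (Metric.ball (φ z) (r / c₂ x)) := by
          rw [Measure.addHaar_ball_of_pos _ _ hR, finrank_euclideanSpace_fin,
            ← ENNReal.ofReal_toReal (measure_ball_lt_top (x := (0 : EuclideanSpace ℝ (Fin d)))).ne,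
            ← ENNReal.ofReal_mul (by positivity), ← ENNReal.ofReal_mul (hc₁ x).le]
          congr 1
          change _ = _ * (_ * v₁)
          rw [div_pow, div_pow]
          ring
      _ = ∫⁻ _ in Metric.ball (φ z) (r / c₂ x), ENNReal.ofReal (c₁ x) :=
          (setLIntegral_const _ _).symm
      _ ≤ ∫⁻ u in Metric.ball (φ z) (r / c₂ x), ENNReal.ofReal (Real.sqrt (gram g x u).det) :=
          setLIntegral_mono' measurableSet_ball fun u hu =>
            ENNReal.ofReal_le_ofReal (hdens x u (hB hu)).1
      _ ≤ _ := lintegral_mono_set hBS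
  rcases t.eq_empty_or_nonempty with h | hne
  · subst h
    refine ⟨1, 1, one_pos, one_pos, fun x => ?_⟩
    have : x ∈ (⊤ : Set M) := trivial
    rw [← ht] at this
    simp at this
  have hpos : ∀ x, 0 < c₁ x * ((1 / c₂ x) ^ d * v₁) := fun x => by
    have := hc₁ x; have := hc₂ x; positivity
  refine ⟨t.inf' hne fun x => c₁ x * ((1 / c₂ x) ^ d * v₁), t.inf' hne fun x => c₂ x * ρ x,
    (Finset.lt_inf'_iff _).2 fun x _ => hpos x,
    (Finset.lt_inf'_iff _).2 fun x _ => mul_pos (hc₂ x) (hρ x), fun z r hr hr₀ => ?_⟩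
  have : z ∈ (⊤ : Set M) := trivial
  rw [← ht] at this
  simp only [Set.mem_iUnion] at this
  obtain ⟨x, hxt, hz⟩ := this
  refine le_trans (ENNReal.ofReal_le_ofReal ?_)
    (hloc x z hz r hr (hr₀.trans (Finset.inf'_le _ hxt)))
  gcongr
  exact Finset.inf'_le (fun x => c₁ x * ((1 / c₂ x) ^ d * v₁)) hxt

theorem isFiniteMeasure_riemannianMeasure [CompactSpace M] (hι : IsIsometricEmbedding g ι) :
    IsFiniteMeasure (riemannianMeasure g) := by
  obtain ⟨C, -, hC⟩ := exists_riemannianMeasure_ball_le (ι := ι) hι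
  obtain ⟨R, hR⟩ := (isCompact_range hι.isEmbedding.continuous).isBounded.exists_norm_le
  refine ⟨?_⟩
  rcases isEmpty_or_nonempty M with h | ⟨⟨x⟩⟩
  · rw [Set.univ_eq_empty_iff.2 h]; simp
  have hR0 : 0 ≤ R := (norm_nonneg _).trans (hR _ ⟨x, rfl⟩)
  refine lt_of_le_of_lt ?_ (ENNReal.ofReal_lt_top (r := C * (2 * R + 1) ^ d))
  refine le_trans (measure_mono fun y _ => ?_) (hC x (2 * R + 1) (by positivity))
  have h1 := norm_sub_le (ι x) (ι y)
  have h2 := hR _ ⟨x, rfl⟩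
  have h3 := hR _ ⟨y, rfl⟩
  change ‖ι x - ι y‖ < _
  linarith

end Volume

/-! ### Bernstein-type concentration -/

section Concentration

variable {Ω : Type*} [MeasurableSpace Ω] {P : Measure Ω} [IsProbabilityMeasure P]

/-- Integrate exp u ≤ 1 + u + u², valid for |u| ≤ 1, at u = tξ; the linear term vanishes by
centring. -/
theorem mgf_le_exp_of_bounded {ξ : Ω → ℝ} (hm : Measurable ξ) {B v t : ℝ}
    (hB : ∀ s, |ξ s| ≤ B) (h0 : ∫ s, ξ s ∂P = 0) (hv : ∫ s, ξ s ^ 2 ∂P ≤ v)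
    (ht : 0 ≤ t) (htB : t * B ≤ 1) : mgf ξ P t ≤ Real.exp (t ^ 2 * v) := by
  have hi1 : Integrable ξ P := Integrable.of_bound hm.aestronglyMeasurable B
    (Eventually.of_forall fun s => by rw [Real.norm_eq_abs]; exact hB s)
  have hi2 : Integrable (fun s => ξ s ^ 2) P :=
    Integrable.of_bound (hm.pow_const 2).aestronglyMeasurable (B ^ 2)
      (Eventually.of_forall fun s => by
        rw [Real.norm_eq_abs, abs_pow]
        gcongr
        exact hB s)
  have hpt : ∀ s, Real.exp (t * ξ s) ≤ 1 + t * ξ s + t ^ 2 * ξ s ^ 2 := fun s => by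
    have h1 : |t * ξ s| ≤ 1 := by
      rw [abs_mul, abs_of_nonneg ht]
      exact (mul_le_mul_of_nonneg_left (hB s) ht).trans htB
    have h2 := (abs_le.1 (Real.abs_exp_sub_one_sub_id_le h1)).2
    nlinarith
  have hi3 : Integrable (fun s => 1 + t * ξ s) P := (integrable_const _).add (hi1.const_mul t)
  have hint : Integrable (fun s => 1 + t * ξ s + t ^ 2 * ξ s ^ 2) P := hi3.add (hi2.const_mul _)
  calc mgf ξ P t ≤ ∫ s, (1 + t * ξ s + t ^ 2 * ξ s ^ 2) ∂P :=
        integral_mono_of_nonneg (Eventually.of_forall fun s => (Real.exp_pos _).le) hint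
          (Eventually.of_forall hpt)
    _ = 1 + t ^ 2 * ∫ s, ξ s ^ 2 ∂P := by
        rw [integral_add hi3 (hi2.const_mul _),
          integral_add (integrable_const _) (hi1.const_mul t), integral_const_mul,
          integral_const_mul, h0]
        simp
    _ ≤ t ^ 2 * v + 1 := by nlinarith [sq_nonneg t]
    _ ≤ _ := Real.add_one_le_exp _

/-- A one-sided Bernstein inequality for sums of independent bounded centred variables, in the
Gaussian regime `L B² ≤ N v`. -/
theorem measure_sum_ge_le_exp {N : ℕ} {ξ : Fin N → Ω → ℝ} (hm : ∀ k, Measurable (ξ k))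
    (hind : iIndepFun ξ P) {B v L : ℝ} (hB : ∀ k s, |ξ k s| ≤ B)
    (h0 : ∀ k, ∫ s, ξ k s ∂P = 0)
    (hv : ∀ k, ∫ s, ξ k s ^ 2 ∂P ≤ v) (hN : 0 < N) (hL : 0 ≤ L) (hv0 : 0 < v)
    (hLB : L * B ^ 2 ≤ N * v) :
    P {s | 4 * Real.sqrt (N * v * L) ≤ ∑ k, ξ k s} ≤ ENNReal.ofReal (Real.exp (-(3 * L))) := by
  have hN' : (0 : ℝ) < N := by exact_mod_cast hN
  -- This choice gives t²Nv = L, and the hypothesis `hLB` is exactly what yields tB ≤ 1. The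
  -- Chernoff exponent is then -4L + L = -3L.
  set t := Real.sqrt (L / (N * v)) with ht
  have ht0 : 0 ≤ t := Real.sqrt_nonneg _
  have ht2 : t ^ 2 = L / (N * v) := Real.sq_sqrt (by positivity)
  have htB : t * B ≤ 1 := by
    apply abs_le_of_sq_le_sq' _ zero_le_one |>.2
    rw [mul_pow, ht2, one_pow, div_mul_eq_mul_div, div_le_one (by positivity)]
    exact hLB
  have hprod : t * Real.sqrt (N * v * L) = L := by
    rw [ht, ← Real.sqrt_mul (by positivity)]
    rw [show L / (N * v) * (N * v * L) = L ^ 2 by field_simp, Real.sqrt_sq hL]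
  have hsm : Measurable fun s => ∑ k, ξ k s := Finset.measurable_sum _ fun k _ => hm k
  have hint : Integrable (fun s => Real.exp (t * ∑ k, ξ k s)) P := by
    refine Integrable.of_bound (Real.measurable_exp.comp (hsm.const_mul t)).aestronglyMeasurable
      (Real.exp (t * (N * B))) (Eventually.of_forall fun s => ?_)
    rw [Real.norm_eq_abs, Real.abs_exp]
    gcongr
    calc ∑ k, ξ k s ≤ ∑ _k : Fin N, B := Finset.sum_le_sum fun k _ => (abs_le.1 (hB k s)).2
      _ = N * B := by simp
  have h1 := measure_ge_le_exp_mul_mgf (μ := P) (X := fun s => ∑ k, ξ k s)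
    (4 * Real.sqrt (N * v * L)) ht0 hint
  have h2 : mgf (fun s => ∑ k, ξ k s) P t ≤ Real.exp L := by
    have h3 := hind.mgf_sum (t := t) hm Finset.univ
    have h4 : (∑ k, ξ k) = fun s => ∑ k, ξ k s := by ext s; simp
    rw [h4] at h3
    rw [h3]
    calc ∏ k, mgf (ξ k) P t ≤ ∏ _k : Fin N, Real.exp (t ^ 2 * v) :=
          Finset.prod_le_prod (fun k _ => mgf_nonneg) fun k _ =>
            mgf_le_exp_of_bounded (hm k) (hB k) (h0 k) (hv k) ht0 htB
      _ = Real.exp L := by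
          rw [Finset.prod_const, Finset.card_univ, Fintype.card_fin, ← Real.exp_nat_mul, ht2]
          congr 1
          field_simp
  rw [← ofReal_measureReal (measure_ne_top _ _)]
  apply ENNReal.ofReal_le_ofReal
  refine h1.trans ?_
  calc _ ≤ Real.exp (-t * (4 * Real.sqrt (N * v * L))) * Real.exp L := by gcongr
    _ = Real.exp (-(3 * L)) := by
        rw [← Real.exp_add]
        congr 1
        linear_combination (-4) * hprod

variable {E : Type*} [MeasurableSpace E] {ν : Measure E}

/-- Centring doubles the sup bound, whence the 4 in `hLB`, and does not increase the second moment.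
The two signs give the factor 2. -/
theorem measure_abs_average_sub_integral_gt_le {N : ℕ} {V : Fin N → Ω → E}
    (hV : ∀ k, Measurable (V k)) (hind : iIndepFun V P) (hlaw : ∀ k, P.map (V k) = ν)
    {φ : E → ℝ} (hφ : Measurable φ) {B v L : ℝ} (hB : ∀ y, |φ y| ≤ B)
    (hv : ∫ y, φ y ^ 2 ∂ν ≤ v) (hN : 0 < N) (hL : 0 ≤ L) (hv0 : 0 < v)
    (hLB : 4 * L * B ^ 2 ≤ N * v) :
    P {s | 4 * Real.sqrt (v * L / N) < |(∑ k, φ (V k s)) / N - ∫ y, φ y ∂ν|} ≤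
      ENNReal.ofReal (2 * Real.exp (-(3 * L))) := by
  have hN' : (0 : ℝ) < N := by exact_mod_cast hN
  have hprob : IsProbabilityMeasure ν := by
    rw [← hlaw ⟨0, hN⟩]
    exact Measure.isProbabilityMeasure_map (hV _).aemeasurable
  have hiφ : Integrable φ ν := Integrable.of_bound hφ.aestronglyMeasurable B
    (Eventually.of_forall fun s => by rw [Real.norm_eq_abs]; exact hB s)
  have hiφ2 : Integrable (fun s => φ s ^ 2) ν :=
    Integrable.of_bound (hφ.pow_const 2).aestronglyMeasurable (B ^ 2)
      (Eventually.of_forall fun s => by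
        rw [Real.norm_eq_abs, abs_pow]
        gcongr
        exact hB s)
  set m := ∫ y, φ y ∂ν with hm
  have hmB : |m| ≤ B := by
    have := norm_integral_le_of_norm_le_const (μ := ν) (f := φ) (C := B)
      (Eventually.of_forall fun s => by rw [Real.norm_eq_abs]; exact hB s)
    simpa using this
  have key : ∀ σ : ℝ, |σ| = 1 →
      P {s | 4 * Real.sqrt (N * v * L) ≤ ∑ k, σ * (φ (V k s) - m)} ≤
        ENNReal.ofReal (Real.exp (-(3 * L))) := by
    intro σ hσ
    have hσm : Measurable fun y => σ * (φ y - m) := (hφ.sub_const m).const_mul σ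
    have hσ2 : σ ^ 2 = 1 := by rw [← sq_abs, hσ, one_pow]
    refine measure_sum_ge_le_exp (B := 2 * B) (v := v) (fun k => hσm.comp (hV k))
      (hind.comp (fun _ y => σ * (φ y - m)) fun _ => hσm) ?_ ?_ ?_ hN hL hv0
      (by linarith)
    · intro k s
      rw [Function.comp_apply, abs_mul, hσ, one_mul]
      have := abs_sub (φ (V k s)) m
      have := hB (V k s)
      linarith
    · intro k
      have h1 := integral_map (μ := P) (hV k).aemeasurable (f := fun y => σ * (φ y - m))
        hσm.aestronglyMeasurable
      rw [hlaw k] at h1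
      refine h1.symm.trans ?_
      rw [integral_const_mul, integral_sub hiφ (integrable_const _)]
      simp [hm]
    · intro k
      have h1 := integral_map (μ := P) (hV k).aemeasurable (f := fun y => (σ * (φ y - m)) ^ 2)
        (hσm.pow_const 2).aestronglyMeasurable
      rw [hlaw k] at h1
      refine h1.symm.le.trans ?_
      have h2 : ∀ y, (σ * (φ y - m)) ^ 2 = φ y ^ 2 - (2 * m) * φ y + m ^ 2 := fun y => by
        rw [mul_pow, hσ2]; ring
      simp_rw [h2]
      have h3 : Integrable (fun y => φ y ^ 2 - (2 * m) * φ y) ν := hiφ2.sub (hiφ.const_mul _)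
      rw [integral_add h3 (integrable_const _),
        integral_sub hiφ2 (hiφ.const_mul _), integral_const_mul, ← hm]
      simp only [integral_const, probReal_univ, one_smul]
      nlinarith [sq_nonneg m]
  have hsub : {s | 4 * Real.sqrt (v * L / N) < |(∑ k, φ (V k s)) / N - m|} ⊆
      {s | 4 * Real.sqrt (N * v * L) ≤ ∑ k, 1 * (φ (V k s) - m)} ∪
      {s | 4 * Real.sqrt (N * v * L) ≤ ∑ k, (-1) * (φ (V k s) - m)} := by
    intro s hs
    have hsq : Real.sqrt (N * v * L) = N * Real.sqrt (v * L / N) := by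
      rw [show (N : ℝ) * v * L = N ^ 2 * (v * L / N) by field_simp,
        Real.sqrt_mul (by positivity), Real.sqrt_sq hN'.le]
    have hsum : ∑ k, (φ (V k s) - m) = N * ((∑ k, φ (V k s)) / N - m) := by
      rw [Finset.sum_sub_distrib]
      simp only [Finset.sum_const, Finset.card_univ, Fintype.card_fin, nsmul_eq_mul]
      field_simp
    simp only [Set.mem_union, Set.mem_ofPred_eq, ← Finset.mul_sum, hsum, hsq] at hs ⊢
    rcases lt_abs.1 hs with h | h
    · left; nlinarith
    · right; nlinarith
  refine (measure_mono hsub).trans ((measure_union_le _ _).trans ?_)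
  rw [two_mul, ENNReal.ofReal_add (by positivity) (by positivity)]
  exact add_le_add (key 1 (by simp)) (key (-1) (by simp))

/-- Concentration of the average of `φ (Z, V k)`, with `Z` independent of the sample `V`. -/
theorem measure_abs_average_sub_integral_gt_le_of_indepFun {F : Type*} [MeasurableSpace F]
    {N : ℕ} {V : Fin N → Ω → E} {Z : Ω → F}
    (hV : ∀ k, Measurable (V k)) (hZ : Measurable Z) (hind : iIndepFun V P)
    (hZV : IndepFun Z (fun s k => V k s) P) (hlaw : ∀ k, P.map (V k) = ν) [SFinite ν]
    {φ : F → E → ℝ} (hφ : Measurable (Function.uncurry φ)) {B v L : ℝ}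
    (hB : ∀ z y, |φ z y| ≤ B)
    (hv : ∀ z, ∫ y, φ z y ^ 2 ∂ν ≤ v) (hN : 0 < N) (hL : 0 ≤ L) (hv0 : 0 < v)
    (hLB : 4 * L * B ^ 2 ≤ N * v) :
    P {s | 4 * Real.sqrt (v * L / N) < |(∑ k, φ (Z s) (V k s)) / N - ∫ y, φ (Z s) y ∂ν|} ≤
      ENNReal.ofReal (2 * Real.exp (-(3 * L))) := by
  have hVm : Measurable fun s k => V k s := measurable_pi_lambda _ hV
  set S : Set (F × (Fin N → E)) :=
    {p | 4 * Real.sqrt (v * L / N) < |(∑ k, φ p.1 (p.2 k)) / N - ∫ y, φ p.1 y ∂ν|} with hS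
  have hSm : MeasurableSet S := by
    refine measurableSet_lt measurable_const (Measurable.abs (Measurable.sub ?_ ?_))
    · refine (Finset.measurable_sum _ fun k _ => ?_).div_const _
      exact hφ.comp (measurable_fst.prodMk ((measurable_pi_apply k).comp measurable_snd))
    · exact (hφ.stronglyMeasurable.integral_prod_right.measurable).comp measurable_fst
  -- By independence the joint law is a product, so Fubini freezes Z = z and the fixed-function
  -- bound applies to every section.
  have hmap := (indepFun_iff_map_prod_eq_prod_map_map hZ.aemeasurable hVm.aemeasurable).1 hZV
  have hPF : IsProbabilityMeasure (P.map Z) := Measure.isProbabilityMeasure_map hZ.aemeasurable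
  have hPV : IsProbabilityMeasure (P.map fun s k => V k s) :=
    Measure.isProbabilityMeasure_map hVm.aemeasurable
  calc _ = P.map (fun s => (Z s, fun k => V k s)) S := by
        rw [Measure.map_apply (hZ.prodMk hVm) hSm]
        rfl
    _ = ∫⁻ z, P.map (fun s k => V k s) (Prod.mk z ⁻¹' S) ∂(P.map Z) := by
        rw [hmap, Measure.prod_apply hSm]
    _ ≤ ∫⁻ _, ENNReal.ofReal (2 * Real.exp (-(3 * L))) ∂(P.map Z) := by
        refine lintegral_mono fun z => ?_
        simp only
        rw [Measure.map_apply hVm (measurable_prodMk_left hSm)]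
        exact measure_abs_average_sub_integral_gt_le hV hind hlaw (hφ.of_uncurry_left (x := z))
          (hB z) (hv z) hN hL hv0 hLB
    _ = _ := by simp

end Concentration

/-! ### Kernel integrals at scale s -/

section KernelIntegrals

variable {D d : ℕ} {M : Type*} [MeasurableSpace M] {ι : M → EuclideanSpace ℝ (Fin D)}

/-- Decompose into shells of width s: on shell j the integrand is at most exp(-cj), and the shell
lies in a ball of measure at most C((j+1)s)^d. The series over j converges independently of s. -/
theorem exists_lintegral_exp_le {C c : ℝ} (hC : 0 < C) (hc : 0 < c) (hι : Measurable ι) :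
    ∃ C' : ℝ, 0 < C' ∧ ∀ μ : Measure M,
      (∀ (x : M) (r : ℝ), 0 < r → μ {y | ‖ι x - ι y‖ < r} ≤ ENNReal.ofReal (C * r ^ d)) →
      ∀ (s : ℝ) (x : M), 0 < s →
        ∫⁻ y, ENNReal.ofReal (Real.exp (-(c * (‖ι x - ι y‖ / s)))) ∂μ ≤
          ENNReal.ofReal (C' * s ^ d) := by
  have hsum : Summable fun j : ℕ => Real.exp (-(c * j)) * ((j : ℝ) + 1) ^ d := by
    have h1 := (summable_nat_add_iff 1).2 (Real.summable_pow_mul_exp_neg_nat_mul d hc)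
    refine (h1.mul_left (Real.exp c)).congr fun j => ?_
    push_cast
    rw [mul_left_comm, ← Real.exp_add, mul_comm]
    congr 2
    ring
  have hnn : ∀ j : ℕ, 0 ≤ Real.exp (-(c * j)) * ((j : ℝ) + 1) ^ d := fun j => by positivity
  set S := ∑' j : ℕ, Real.exp (-(c * j)) * ((j : ℝ) + 1) ^ d with hS
  have hSpos : 0 < S := hsum.tsum_pos hnn 0 (by simp)
  refine ⟨C * S, by positivity, fun μ hμ s x hs => ?_⟩
  have hBm : ∀ r : ℝ, MeasurableSet {y | ‖ι x - ι y‖ < r} := fun r =>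
    measurableSet_lt (measurable_const.sub hι).norm measurable_const
  have hpt : ∀ y, ENNReal.ofReal (Real.exp (-(c * (‖ι x - ι y‖ / s)))) ≤
      ∑' j : ℕ, {y | ‖ι x - ι y‖ < ((j : ℝ) + 1) * s}.indicator
        (fun _ => ENNReal.ofReal (Real.exp (-(c * j)))) y := fun y => by
    have h0 : 0 ≤ ‖ι x - ι y‖ / s := by positivity
    refine le_trans ?_ (ENNReal.le_tsum ⌊‖ι x - ι y‖ / s⌋₊)
    rw [Set.indicator_of_mem]
    · apply ENNReal.ofReal_le_ofReal
      gcongr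
      exact Nat.floor_le h0
    · change ‖ι x - ι y‖ < _
      rw [← div_lt_iff₀ hs]
      exact Nat.lt_floor_add_one _
  calc _ ≤ ∫⁻ y, ∑' j : ℕ, {y | ‖ι x - ι y‖ < ((j : ℝ) + 1) * s}.indicator
        (fun _ => ENNReal.ofReal (Real.exp (-(c * j)))) y ∂μ := lintegral_mono hpt
    _ = ∑' j : ℕ, ENNReal.ofReal (Real.exp (-(c * j))) *
          μ {y | ‖ι x - ι y‖ < ((j : ℝ) + 1) * s} := by
        rw [lintegral_tsum fun j => (measurable_const.indicator (hBm _)).aemeasurable]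
        congr 1
        ext j
        rw [lintegral_indicator_const (hBm _)]
    _ ≤ ∑' j : ℕ, ENNReal.ofReal
          ((C * s ^ d) * (Real.exp (-(c * j)) * ((j : ℝ) + 1) ^ d)) := by
        refine ENNReal.tsum_le_tsum fun j => ?_
        refine (mul_le_mul_right (hμ x (((j : ℝ) + 1) * s) (by positivity)) _).trans (le_of_eq ?_)
        rw [← ENNReal.ofReal_mul (by positivity)]
        congr 1
        rw [mul_pow]
        ring
    _ = _ := by
        rw [← ENNReal.ofReal_tsum_of_nonneg (fun j => mul_nonneg (by positivity) (hnn j))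
          (hsum.mul_left _), tsum_mul_left]
        congr 1
        rw [← hS]
        ring

theorem exists_integral_exp_le {C c : ℝ} (hC : 0 < C) (hc : 0 < c) (hι : Measurable ι) :
    ∃ C' : ℝ, 0 < C' ∧ ∀ μ : Measure M,
      (∀ (x : M) (r : ℝ), 0 < r → μ {y | ‖ι x - ι y‖ < r} ≤ ENNReal.ofReal (C * r ^ d)) →
      ∀ (s : ℝ) (x : M), 0 < s →
        ∫ y, Real.exp (-(c * (‖ι x - ι y‖ / s))) ∂μ ≤ C' * s ^ d := by
  obtain ⟨C', hC', h⟩ := exists_lintegral_exp_le (M := M) (d := d) hC hc hι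
  refine ⟨C', hC', fun μ hμ s x hs => ?_⟩
  have hm : Measurable fun y => Real.exp (-(c * (‖ι x - ι y‖ / s))) := by fun_prop
  rw [integral_eq_lintegral_of_nonneg_ae (Eventually.of_forall fun y => (Real.exp_pos _).le)
    hm.aestronglyMeasurable]
  exact ENNReal.toReal_le_of_le_ofReal (by positivity) (h μ hμ s x hs)

/-- By continuity K exceeds K(0)/2 on some [0, δ), so the ball of radius sδ alone contributes order
s^d. -/
theorem IsKernel.exists_le_integral {K : ℝ → ℝ} (hK : IsKernel d K) {c r₀ : ℝ} (hc : 0 < c)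
    (hr₀ : 0 < r₀) (hι : Measurable ι) :
    ∃ c' s₀ : ℝ, 0 < c' ∧ 0 < s₀ ∧ ∀ μ : Measure M,
      (∀ (x : M) (r : ℝ), 0 < r → r ≤ r₀ →
        ENNReal.ofReal (c * r ^ d) ≤ μ {y | ‖ι x - ι y‖ < r}) →
      ∀ (s : ℝ) (x : M), 0 < s → s ≤ s₀ → Integrable (fun y => K (‖ι x - ι y‖ / s)) μ →
        c' * s ^ d ≤ ∫ y, K (‖ι x - ι y‖ / s) ∂μ := by
  have hcont : ContinuousWithinAt K (Set.Ici 0) 0 :=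
    hK.contDiffOn.continuousOn 0 Set.self_mem_Ici
  have h0 := hK.pos_zero
  have hev : ∀ᶠ t in 𝓝[≥] (0 : ℝ), K 0 / 2 < K t :=
    hcont.eventually (lt_mem_nhds (by linarith))
  obtain ⟨δ, hδ, hKδ⟩ := _root_.Metric.mem_nhdsWithin_iff.1 hev
  refine ⟨K 0 / 2 * (c * δ ^ d), r₀ / δ, by positivity, by positivity,
    fun μ hμ s x hs hs₀ hint => ?_⟩
  have hδ' : 0 < δ := hδ
  rw [le_div_iff₀ hδ'] at hs₀
  set B := {y | ‖ι x - ι y‖ < s * δ} with hB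
  have hBm : MeasurableSet B := measurableSet_lt (measurable_const.sub hι).norm measurable_const
  have hKB : ∀ y ∈ B, K 0 / 2 ≤ K (‖ι x - ι y‖ / s) := fun y hy => by
    have h1 : 0 ≤ ‖ι x - ι y‖ / s := by positivity
    refine (hKδ ⟨?_, h1⟩).le
    rw [_root_.Metric.mem_ball, Real.dist_eq, sub_zero, abs_of_nonneg h1, div_lt_iff₀ hs, mul_comm]
    exact hy
  have hKnn : ∀ y, 0 ≤ K (‖ι x - ι y‖ / s) := fun y => hK.nonneg _ (by positivity)
  -- Finiteness of `μ` is not assumed; it follows on `B` from integrability, as the integrand is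
  -- bounded below there.
  have hμB : μ B ≠ ⊤ := by
    have h1 := hint.measure_norm_ge_lt_top (ε := K 0 / 2) (by positivity)
    refine ((measure_mono fun y hy => ?_).trans_lt h1).ne
    exact (hKB y hy).trans (le_abs_self _)
  have h2 : c * (s * δ) ^ d ≤ μ.real B :=
    (ENNReal.ofReal_le_iff_le_toReal hμB).1 (hμ x (s * δ) (by positivity) hs₀)
  calc _ = c * (s * δ) ^ d * (K 0 / 2) := by rw [mul_pow]; ring
    _ ≤ μ.real B * (K 0 / 2) := by gcongr
    _ = ∫ _ in B, K 0 / 2 ∂μ := by rw [setIntegral_const, smul_eq_mul]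
    _ ≤ ∫ y in B, K (‖ι x - ι y‖ / s) ∂μ :=
        setIntegral_mono_on (integrableOn_const hμB) hint.integrableOn hBm hKB
    _ ≤ _ := setIntegral_le_integral hint (Eventually.of_forall hKnn)

/-- An exponential bound on `K (t)` and `t K (t)`. -/
theorem IsKernel.exists_exp_bound {K : ℝ → ℝ} (hK : IsKernel d K) :
    ∃ A c : ℝ, 0 < A ∧ 0 < c ∧ ∀ t : ℝ, 0 ≤ t →
      K t ≤ A * Real.exp (-(c * t)) ∧ K t * t ≤ A * Real.exp (-(c * t)) := by
  obtain ⟨A, c, hc, h⟩ := hK.decay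
  have hA : 0 < A := by
    have h1 := h 0 le_rfl
    simp only [mul_zero, neg_zero, Real.exp_zero, mul_one] at h1
    linarith [hK.pos_zero]
  have hhalf : ∀ t : ℝ, Real.exp (-(c * t)) = Real.exp (-(c / 2 * t)) * Real.exp (-(c / 2 * t)) :=
    fun t => by rw [← Real.exp_add]; congr 1; ring
  -- Half of the decay rate is spent on the factor t, through t exp(-ct/2) ≤ 2/c.
  refine ⟨A * (1 + 2 / c), c / 2, by positivity, by positivity, fun t ht => ?_⟩
  have h1 := h t ht
  have he : Real.exp (-(c / 2 * t)) ≤ 1 := Real.exp_le_one_iff.2 (by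
    have : 0 ≤ c / 2 * t := by positivity
    linarith)
  have hp := Real.exp_pos (-(c / 2 * t))
  have h2 : t * Real.exp (-(c / 2 * t)) ≤ 2 / c := by
    have h3 : c / 2 * t ≤ Real.exp (c / 2 * t) := by
      linarith [Real.add_one_le_exp (c / 2 * t)]
    rw [Real.exp_neg, ← div_eq_mul_inv, div_le_div_iff₀ (Real.exp_pos _) hc]
    linarith
  rw [hhalf] at h1
  constructor
  · calc K t ≤ A * (Real.exp (-(c / 2 * t)) * Real.exp (-(c / 2 * t))) := h1
      _ ≤ A * (1 * Real.exp (-(c / 2 * t))) := by gcongr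
      _ ≤ A * ((1 + 2 / c) * Real.exp (-(c / 2 * t))) := by
          gcongr
          have : 0 ≤ 2 / c := by positivity
          linarith
      _ = _ := by ring
  · calc K t * t ≤ A * (Real.exp (-(c / 2 * t)) * Real.exp (-(c / 2 * t))) * t := by gcongr
      _ = A * ((t * Real.exp (-(c / 2 * t))) * Real.exp (-(c / 2 * t))) := by ring
      _ ≤ A * ((1 + 2 / c) * Real.exp (-(c / 2 * t))) := by
          gcongr
          linarith
      _ = _ := by ring

end KernelIntegrals

/-- A symmetric kernel `k` at scale `h` (the order of `∫ k`), dominated by `H`, together with a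
function `f` whose oscillation on the support scale of `k` is of order `b`. -/
structure IsScaledKernel {M : Type*} [MeasurableSpace M] (μ ν : Measure M) (k H : M → M → ℝ)
    (f : M → ℝ) (A a b h : ℝ) : Prop where
  meas_k : Measurable (Function.uncurry k)
  meas_H : Measurable (Function.uncurry H)
  meas_f : Measurable f
  symm : ∀ x y, k x y = k y x
  nonneg : ∀ x y, 0 ≤ k x y
  le_mul : ∀ x y, k x y ≤ A * H x y
  osc_le : ∀ x y, k x y * |f y - f x| ≤ A * b * H x y
  H_nonneg : ∀ x y, 0 ≤ H x y
  H_le_one : ∀ x y, H x y ≤ 1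
  integral_H_left : ∀ x, ∫ y, H x y ∂μ ≤ A * h
  integral_H_right : ∀ x, ∫ y, H x y ∂ν ≤ A * h
  le_integral_left : ∀ x, a * h ≤ ∫ y, k x y ∂μ
  le_integral_right : ∀ x, a * h ≤ ∫ y, k x y ∂ν
  one_le : 1 ≤ A
  a_pos : 0 < a
  b_pos : 0 < b
  h_pos : 0 < h

/-! ### Population averages of a scaled kernel -/

section Averages

variable {M : Type*} [MeasurableSpace M]

/-- The mean oscillation `∫ k(y, x) (f(x) - f(y)) dμ(x)`. -/
noncomputable def oscMean (μ : Measure M) (k : M → M → ℝ) (f : M → ℝ) (y : M) : ℝ :=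
  ∫ x, k y x * (f x - f y) ∂μ

/-- The mean mass `∫ k(y, x) dμ(x)`. -/
noncomputable def massMean (μ : Measure M) (k : M → M → ℝ) (y : M) : ℝ :=
  ∫ x, k y x ∂μ

/-- The contribution `k(z, y) ∫ k(y, x) (f(x) - f(z)) dμ(x)` of a landmark `y`. -/
noncomputable def landmarkOsc (μ : Measure M) (k : M → M → ℝ) (f : M → ℝ) (z y : M) : ℝ :=
  k z y * (oscMean μ k f y + (f y - f z) * massMean μ k y)

theorem integrable_of_abs_le {μ : Measure M} [IsFiniteMeasure μ] {φ : M → ℝ} (hφ : Measurable φ)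
    {B : ℝ} (hB : ∀ x, |φ x| ≤ B) : Integrable φ μ :=
  Integrable.of_bound hφ.aestronglyMeasurable B
    (Eventually.of_forall fun s => by rw [Real.norm_eq_abs]; exact hB s)

theorem abs_integral_le_of_abs_le {μ : Measure M} {φ ψ : M → ℝ} (hψ : Integrable ψ μ)
    (h : ∀ x, |φ x| ≤ ψ x) : |∫ x, φ x ∂μ| ≤ ∫ x, ψ x ∂μ := by
  have := norm_integral_le_of_norm_le hψ (f := φ)
    (Eventually.of_forall fun s => by rw [Real.norm_eq_abs]; exact h s)
  rwa [Real.norm_eq_abs] at this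

namespace IsScaledKernel

variable {μ ν : Measure M} {k H : M → M → ℝ} {f : M → ℝ} {A a b h : ℝ}
  (S : IsScaledKernel μ ν k H f A a b h)

include S

theorem A_pos : 0 < A := one_pos.trans_le S.one_le

theorem abs_H (x y : M) : |H x y| ≤ 1 := by
  rw [abs_of_nonneg (S.H_nonneg x y)]; exact S.H_le_one x y

theorem abs_k (x y : M) : |k x y| ≤ A * H x y := by
  rw [abs_of_nonneg (S.nonneg x y)]; exact S.le_mul x y

theorem abs_osc (x y : M) : |k x y * (f y - f x)| ≤ A * b * H x y := by
  rw [abs_mul, abs_of_nonneg (S.nonneg x y)]; exact S.osc_le x y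

theorem integrable_H (ρ : Measure M) [IsFiniteMeasure ρ] (x : M) : Integrable (H x) ρ :=
  integrable_of_abs_le (S.meas_H.of_uncurry_left) (S.abs_H x)

theorem integrable_k (ρ : Measure M) [IsFiniteMeasure ρ] (x : M) : Integrable (k x) ρ :=
  integrable_of_abs_le (S.meas_k.of_uncurry_left) (B := A) fun y =>
    (S.abs_k x y).trans (mul_le_of_le_one_right S.A_pos.le (S.H_le_one x y))

theorem meas_osc : Measurable (Function.uncurry fun x y => k x y * (f y - f x)) :=
  S.meas_k.mul ((S.meas_f.comp measurable_snd).sub (S.meas_f.comp measurable_fst))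

theorem integrable_osc (ρ : Measure M) [IsFiniteMeasure ρ] (x : M) :
    Integrable (fun y => k x y * (f y - f x)) ρ :=
  integrable_of_abs_le (S.meas_osc.of_uncurry_left) (B := A * b) fun y =>
    (S.abs_osc x y).trans
      (mul_le_of_le_one_right (mul_pos S.A_pos S.b_pos).le (S.H_le_one x y))

theorem measurable_oscMean [SFinite μ] : Measurable (oscMean μ k f) :=
  S.meas_osc.stronglyMeasurable.integral_prod_right.measurable

theorem measurable_massMean [SFinite μ] : Measurable (massMean μ k) :=
  S.meas_k.stronglyMeasurable.integral_prod_right.measurable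

theorem abs_oscMean_le [IsFiniteMeasure μ] (y : M) : |oscMean μ k f y| ≤ A ^ 2 * b * h := by
  refine (abs_integral_le_of_abs_le ((S.integrable_H μ y).const_mul (A * b)) (S.abs_osc y)).trans ?_
  rw [integral_const_mul]
  have h1 := mul_le_mul_of_nonneg_left (S.integral_H_left y) (mul_pos S.A_pos S.b_pos).le
  linarith

theorem massMean_nonneg (y : M) : 0 ≤ massMean μ k y := integral_nonneg (S.nonneg y)

theorem massMean_le [IsFiniteMeasure μ] (y : M) : massMean μ k y ≤ A ^ 2 * h := by
  refine (integral_mono (S.integrable_k μ y) ((S.integrable_H μ y).const_mul A)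
    (S.le_mul y)).trans ?_
  rw [integral_const_mul]
  have h1 := mul_le_mul_of_nonneg_left (S.integral_H_left y) S.A_pos.le
  linarith

theorem measurable_landmarkOsc [SFinite μ] : Measurable (Function.uncurry (landmarkOsc μ k f)) :=
  S.meas_k.mul (((S.measurable_oscMean).comp measurable_snd).add
    (((S.meas_f.comp measurable_snd).sub (S.meas_f.comp measurable_fst)).mul
      ((S.measurable_massMean).comp measurable_snd)))

theorem abs_landmarkOsc_le [IsFiniteMeasure μ] (z y : M) :
    |landmarkOsc μ k f z y| ≤ 2 * A ^ 3 * b * h * H z y := by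
  have h1 : landmarkOsc μ k f z y =
      k z y * oscMean μ k f y + k z y * (f y - f z) * massMean μ k y := by
    unfold landmarkOsc; ring
  have hb := S.b_pos
  have hA := S.A_pos
  have hh := S.h_pos
  have hH := S.H_nonneg z y
  rw [h1]
  calc _ ≤ |k z y| * |oscMean μ k f y| + |k z y * (f y - f z)| * |massMean μ k y| := by
        rw [← abs_mul, ← abs_mul]; exact abs_add_le _ _
    _ ≤ (A * H z y) * (A ^ 2 * b * h) + (A * b * H z y) * (A ^ 2 * h) := by
        gcongr
        · exact S.abs_k z y
        · exact S.abs_oscMean_le y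
        · exact S.abs_osc z y
        · rw [abs_of_nonneg (S.massMean_nonneg y)]; exact S.massMean_le y
    _ = _ := by ring

theorem measurable_mul_massMean [SFinite μ] :
    Measurable (Function.uncurry fun z y => k z y * massMean μ k y) :=
  S.meas_k.mul (S.measurable_massMean.comp measurable_snd)

theorem abs_mul_massMean_le [IsFiniteMeasure μ] (z y : M) :
    |k z y * massMean μ k y| ≤ A ^ 3 * h * H z y := by
  have hA := S.A_pos
  have hH := S.H_nonneg z y
  rw [abs_mul, abs_of_nonneg (S.massMean_nonneg y)]
  calc _ ≤ (A * H z y) * (A ^ 2 * h) := by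
        gcongr
        · exact S.massMean_nonneg y
        · exact S.abs_k z y
        · exact S.massMean_le y
    _ = _ := by ring

theorem integrable_mul_massMean [IsFiniteMeasure μ] (ρ : Measure M) [IsFiniteMeasure ρ] (z : M) :
    Integrable (fun y => k z y * massMean μ k y) ρ :=
  integrable_of_abs_le (S.measurable_mul_massMean.of_uncurry_left) (B := A ^ 3 * h) fun y =>
    (S.abs_mul_massMean_le z y).trans
      (mul_le_of_le_one_right (by have := S.A_pos; have := S.h_pos; positivity) (S.H_le_one z y))

theorem abs_integral_landmarkOsc_le [IsFiniteMeasure μ] [IsFiniteMeasure ν] (z : M) :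
    |∫ y, landmarkOsc μ k f z y ∂ν| ≤ 2 * A ^ 4 * b * h ^ 2 := by
  have hb := S.b_pos
  have hA := S.A_pos
  have hh := S.h_pos
  refine (abs_integral_le_of_abs_le ((S.integrable_H ν z).const_mul (2 * A ^ 3 * b * h))
    (S.abs_landmarkOsc_le z)).trans ?_
  rw [integral_const_mul]
  have h1 := mul_le_mul_of_nonneg_left (S.integral_H_right z)
    (by positivity : 0 ≤ 2 * A ^ 3 * b * h)
  linarith

theorem le_integral_mul_massMean [IsFiniteMeasure μ] [IsFiniteMeasure ν] (z : M) :
    a ^ 2 * h ^ 2 ≤ ∫ y, k z y * massMean μ k y ∂ν := by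
  have ha := S.a_pos
  have hh := S.h_pos
  calc a ^ 2 * h ^ 2 = (a * h) * (a * h) := by ring
    _ ≤ (∫ y, k z y ∂ν) * (a * h) := by
        gcongr
        exact S.le_integral_right z
    _ = ∫ y, k z y * (a * h) ∂ν := (integral_mul_const _ _).symm
    _ ≤ _ := integral_mono ((S.integrable_k ν z).mul_const _) (S.integrable_mul_massMean ν z)
        fun y => mul_le_mul_of_nonneg_left (S.le_integral_left y) (S.nonneg z y)

/-- Since 0 ≤ H ≤ 1, H² ≤ H: the second moment is of order h, not merely bounded. This is the source
of the √h in the deviations. -/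
theorem integral_sq_le {ψ : M → M → ℝ} {c : ℝ} {z : M} (ρ : Measure M)
    [IsFiniteMeasure ρ] (hρ : ∫ y, H z y ∂ρ ≤ A * h)
    (hψ : ∀ y, |ψ z y| ≤ c * H z y) : ∫ y, ψ z y ^ 2 ∂ρ ≤ c ^ 2 * (A * h) := by
  have h1 : ∀ y, ψ z y ^ 2 ≤ c ^ 2 * H z y := fun y => by
    have hH := S.H_nonneg z y
    have hH1 := S.H_le_one z y
    calc ψ z y ^ 2 = |ψ z y| ^ 2 := (sq_abs _).symm
      _ ≤ (c * H z y) ^ 2 := by gcongr; exact hψ y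
      _ = c ^ 2 * (H z y * H z y) := by ring
      _ ≤ c ^ 2 * (1 * H z y) := by gcongr
      _ = _ := by ring
  calc _ ≤ ∫ y, c ^ 2 * H z y ∂ρ :=
        integral_mono_of_nonneg (Eventually.of_forall fun y => sq_nonneg _)
          ((S.integrable_H ρ z).const_mul _) (Eventually.of_forall h1)
    _ = c ^ 2 * ∫ y, H z y ∂ρ := integral_const_mul _ _
    _ ≤ _ := by gcongr

end IsScaledKernel

end Averages

/-! ### Perturbation of the ratio and uniform deviation -/

theorem abs_div_sub_div_le {N N' Q Q' δ B e₁ e₂ : ℝ} (hδ : 0 < δ) (hQ : δ ≤ Q) (hB : |N| ≤ B)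
    (hN : |N' - N| ≤ e₁) (hQQ : |Q' - Q| ≤ e₂) (he : e₂ ≤ δ / 2) :
    0 < Q' ∧ |N' / Q' - N / Q| ≤ 2 * e₁ / δ + 2 * B * e₂ / δ ^ 2 := by
  have h1 := (abs_le.1 hQQ).1
  have hQ' : δ / 2 ≤ Q' := by linarith
  have hQ'0 : 0 < Q' := by linarith
  have hQ0 : 0 < Q := by linarith
  have he₁ : 0 ≤ e₁ := (abs_nonneg _).trans hN
  have he₂ : 0 ≤ e₂ := (abs_nonneg _).trans hQQ
  have hB0 : 0 ≤ B := (abs_nonneg _).trans hB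
  refine ⟨hQ'0, ?_⟩
  have h2 : N' / Q' - N / Q = (N' - N) / Q' - N * (Q' - Q) / (Q' * Q) := by field_simp; ring
  rw [h2]
  calc _ ≤ |(N' - N) / Q'| + |N * (Q' - Q) / (Q' * Q)| := abs_sub _ _
    _ = |N' - N| / Q' + |N| * |Q' - Q| / (Q' * Q) := by
        rw [abs_div, abs_div, abs_mul, abs_of_pos hQ'0, abs_of_pos (mul_pos hQ'0 hQ0)]
    _ ≤ e₁ / (δ / 2) + B * e₂ / (δ / 2 * δ) := by gcongr
    _ = _ := by field_simp

namespace IsScaledKernel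

variable {M : Type*} [MeasurableSpace M] {μ ν : Measure M} {k H : M → M → ℝ} {f : M → ℝ}
  {A a b h : ℝ} (S : IsScaledKernel μ ν k H f A a b h)

include S

theorem a_le [IsFiniteMeasure μ] (z : M) : a ≤ A ^ 2 :=
  le_of_mul_le_mul_right ((S.le_integral_left z).trans (S.massMean_le z)) S.h_pos

/-- The deterministic part of the variance analysis: if the relevant empirical averages are close
to their means, then the empirical Markov operator is close to the limiting one. -/
theorem abs_ratio_sub_le [IsFiniteMeasure μ] [IsFiniteMeasure ν] {n m : ℕ} (hn : 0 < n)
    (hm : 0 < m) (x : Fin n → M) (y : Fin m → M) (z : M) {θ : ℝ} (hθ : 0 ≤ θ)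
    (hosc : ∀ l, |(∑ j, k (y l) (x j) * (f (x j) - f (y l))) / n - oscMean μ k f (y l)| ≤
      4 * A ^ 2 * b * θ)
    (hmass : ∀ l, |(∑ j, k (y l) (x j)) / n - massMean μ k (y l)| ≤ 4 * A ^ 2 * θ)
    (hH : |(∑ l, H z (y l)) / m - ∫ y, H z y ∂ν| ≤ 4 * A * θ)
    (hland : |(∑ l, landmarkOsc μ k f z (y l)) / m - ∫ y, landmarkOsc μ k f z y ∂ν| ≤
      8 * A ^ 4 * b * h * θ)
    (hdeg : |(∑ l, k z (y l) * massMean μ k (y l)) / m - ∫ y, k z y * massMean μ k y ∂ν| ≤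
      4 * A ^ 4 * h * θ)
    (hθh : 48 * A ^ 4 * θ ≤ a ^ 2 * h) :
    0 < ∑ j, ∑ l, k z (y l) * k (y l) (x j) ∧
    |(∑ j, (∑ l, k z (y l) * k (y l) (x j)) * f (x j)) / (∑ j, ∑ l, k z (y l) * k (y l) (x j)) -
        f z - (∫ y, landmarkOsc μ k f z y ∂ν) / ∫ y, k z y * massMean μ k y ∂ν| ≤
      (96 * A ^ 4 / a ^ 2 + 96 * A ^ 8 / a ^ 4) * (b * (θ / h)) := by
  have hA := S.A_pos
  have ha := S.a_pos
  have hb := S.b_pos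
  have hh := S.h_pos
  have hA1 := S.one_le
  have hn' : (0 : ℝ) < n := by exact_mod_cast hn
  have hm' : (0 : ℝ) < m := by exact_mod_cast hm
  set N := ∫ y, landmarkOsc μ k f z y ∂ν with hN
  set Q := ∫ y, k z y * massMean μ k y ∂ν with hQ
  set s₁ : Fin m → ℝ := fun l => (∑ j, k (y l) (x j) * (f (x j) - f (y l))) / n with hs₁
  set s₂ : Fin m → ℝ := fun l => (∑ j, k (y l) (x j)) / n with hs₂
  set N' := (∑ l, k z (y l) * (s₁ l + (f (y l) - f z) * s₂ l)) / m with hN'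
  set Q' := (∑ l, k z (y l) * s₂ l) / m with hQ'
  -- The hypothesis `hθh` combined with a ≤ A². It makes the empirical mean of `H` at most Ah + 4Aθ
  -- ≤ 5Ah.
  have hθ' : θ ≤ h := by
    have h1 : a ^ 2 ≤ A ^ 4 := by
      calc a ^ 2 ≤ (A ^ 2) ^ 2 := by gcongr; exact S.a_le z
        _ = _ := by ring
    have h2 : 0 < A ^ 4 := by positivity
    have h3 : A ^ 4 * θ ≤ A ^ 4 * h := by nlinarith [mul_nonneg h2.le hθ]
    exact le_of_mul_le_mul_left h3 h2
  have hT : (∑ l, H z (y l)) / m ≤ 5 * A * h := by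
    have h1 := (abs_le.1 hH).2
    have h2 := S.integral_H_right z
    nlinarith
  -- Replacing the inner averages by their means costs 4 · 5 = 20, and the outer average costs 4.
  -- For the numerator below the counts are 8 · 5 = 40 and 8.
  have hQdiff : |Q' - Q| ≤ 24 * A ^ 4 * h * θ := by
    have h1 : |Q' - (∑ l, k z (y l) * massMean μ k (y l)) / m| ≤ 20 * A ^ 4 * h * θ := by
      rw [hQ', ← sub_div, ← Finset.sum_sub_distrib, abs_div, abs_of_pos hm']
      calc _ ≤ (∑ l, A * H z (y l) * (4 * A ^ 2 * θ)) / (m : ℝ) := by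
            gcongr
            refine (Finset.abs_sum_le_sum_abs _ _).trans (Finset.sum_le_sum fun l _ => ?_)
            rw [← mul_sub, abs_mul]
            have := S.H_nonneg z (y l)
            gcongr
            · exact S.abs_k _ _
            · exact hmass l
        _ = (4 * A ^ 3 * θ) * ((∑ l, H z (y l)) / m) := by
            rw [← Finset.sum_mul, ← Finset.mul_sum]; ring
        _ ≤ (4 * A ^ 3 * θ) * (5 * A * h) := by gcongr
        _ = _ := by ring
    calc |Q' - Q| ≤ _ := abs_sub_le _ ((∑ l, k z (y l) * massMean μ k (y l)) / m) _
      _ ≤ 20 * A ^ 4 * h * θ + 4 * A ^ 4 * h * θ := add_le_add h1 hdeg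
      _ = _ := by ring
  have hNdiff : |N' - N| ≤ 48 * A ^ 4 * b * h * θ := by
    have h1 : |N' - (∑ l, landmarkOsc μ k f z (y l)) / m| ≤ 40 * A ^ 4 * b * h * θ := by
      rw [hN', ← sub_div, ← Finset.sum_sub_distrib, abs_div, abs_of_pos hm']
      calc _ ≤ (∑ l, (A * H z (y l) * (4 * A ^ 2 * b * θ) +
              A * b * H z (y l) * (4 * A ^ 2 * θ))) / (m : ℝ) := by
            gcongr
            refine (Finset.abs_sum_le_sum_abs _ _).trans (Finset.sum_le_sum fun l _ => ?_)
            have h2 : k z (y l) * (s₁ l + (f (y l) - f z) * s₂ l) - landmarkOsc μ k f z (y l) =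
                k z (y l) * (s₁ l - oscMean μ k f (y l)) +
                k z (y l) * (f (y l) - f z) * (s₂ l - massMean μ k (y l)) := by
              unfold landmarkOsc; ring
            rw [h2]
            refine (abs_add_le _ _).trans ?_
            rw [abs_mul, abs_mul (k z (y l) * (f (y l) - f z))]
            have := S.H_nonneg z (y l)
            gcongr
            · exact S.abs_k _ _
            · exact hosc l
            · exact S.abs_osc _ _
            · exact hmass l
        _ = (8 * A ^ 3 * b * θ) * ((∑ l, H z (y l)) / m) := by
            rw [← mul_div_assoc, Finset.mul_sum]
            congr 1
            exact Finset.sum_congr rfl fun l _ => by ring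
        _ ≤ (8 * A ^ 3 * b * θ) * (5 * A * h) := by gcongr
        _ = _ := by ring
    calc |N' - N| ≤ _ := abs_sub_le _ ((∑ l, landmarkOsc μ k f z (y l)) / m) _
      _ ≤ 40 * A ^ 4 * b * h * θ + 8 * A ^ 4 * b * h * θ := add_le_add h1 hland
      _ = _ := by ring
  have hDen : ∑ j, ∑ l, k z (y l) * k (y l) (x j) = n * m * Q' := by
    rw [hQ', Finset.sum_comm, mul_assoc, mul_div_cancel₀ _ hm'.ne', Finset.mul_sum]
    refine Finset.sum_congr rfl fun l _ => ?_
    rw [hs₂, ← Finset.mul_sum]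
    field_simp
  -- Subtracting f(z) from f(x_j) isolates the oscillation part; the remaining f(z)Q' cancels after
  -- division.
  have hNum : ∑ j, (∑ l, k z (y l) * k (y l) (x j)) * f (x j) =
      n * m * N' + f z * (n * m * Q') := by
    rw [← hDen, hN', Finset.mul_sum, mul_assoc, mul_div_cancel₀ _ hm'.ne']
    have h1 : ∀ l, (n : ℝ) * (k z (y l) * (s₁ l + (f (y l) - f z) * s₂ l)) =
        ∑ j, k z (y l) * k (y l) (x j) * (f (x j) - f z) := fun l => by
      have h2 : n * s₁ l = ∑ j, k (y l) (x j) * (f (x j) - f (y l)) := mul_div_cancel₀ _ hn'.ne'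
      have h3 : n * s₂ l = ∑ j, k (y l) (x j) := mul_div_cancel₀ _ hn'.ne'
      calc _ = k z (y l) * (n * s₁ l + (f (y l) - f z) * (n * s₂ l)) := by ring
        _ = _ := by
          rw [h2, h3, Finset.mul_sum, ← Finset.sum_add_distrib, Finset.mul_sum]
          exact Finset.sum_congr rfl fun j _ => by ring
    rw [Finset.mul_sum, Finset.sum_congr rfl fun l _ => h1 l, Finset.sum_comm,
      ← Finset.sum_add_distrib]
    refine Finset.sum_congr rfl fun j _ => ?_
    rw [Finset.sum_mul, Finset.mul_sum, ← Finset.sum_add_distrib]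
    exact Finset.sum_congr rfl fun l _ => by ring
  obtain ⟨hpos, hle⟩ := abs_div_sub_div_le (δ := a ^ 2 * h ^ 2) (by positivity)
    (S.le_integral_mul_massMean z) (S.abs_integral_landmarkOsc_le z) hNdiff hQdiff (by
      nlinarith [mul_le_mul_of_nonneg_left hθh hh.le])
  constructor
  · rw [hDen]; positivity
  · rw [hNum, hDen, add_div, mul_div_mul_left _ _ (by positivity : (n : ℝ) * m ≠ 0),
      mul_div_cancel_right₀ _ (by positivity : (n : ℝ) * m * Q' ≠ 0), add_sub_cancel_right]
    refine hle.trans (le_of_eq ?_)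
    field_simp
    ring

variable {Ω : Type*} [MeasurableSpace Ω] {P : Measure Ω} [IsProbabilityMeasure P]

/-- Bernstein with the variance proxy c²A²h; since A ≥ 1, A² may replace the A of `integral_sq_le`,
so that A leaves the square root. -/
theorem measure_abs_average_sub_gt_le {N : ℕ} {V : Fin N → Ω → M} {Z : Ω → M} {ρ : Measure M}
    [IsFiniteMeasure ρ] (hρ : ∀ z, ∫ y, H z y ∂ρ ≤ A * h)
    (hV : ∀ j, Measurable (V j)) (hZ : Measurable Z) (hind : iIndepFun V P)
    (hZV : IndepFun Z (fun s j => V j s) P) (hlaw : ∀ j, P.map (V j) = ρ)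
    {ψ : M → M → ℝ} (hψm : Measurable (Function.uncurry ψ)) {c L : ℝ} (hc : 0 < c)
    (hψ : ∀ z y, |ψ z y| ≤ c * H z y) (hN : 0 < N) (hL : 0 ≤ L) (hLN : 4 * L ≤ N * h) :
    P {s | 4 * A * c * Real.sqrt (h * L / N) < |(∑ j, ψ (Z s) (V j s)) / N - ∫ y, ψ (Z s) y ∂ρ|} ≤
      ENNReal.ofReal (2 * Real.exp (-(3 * L))) := by
  have hA := S.A_pos
  have hh := S.h_pos
  have hA1 := S.one_le
  have h1 := measure_abs_average_sub_integral_gt_le_of_indepFun (B := c) (v := c ^ 2 * A ^ 2 * h)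
    hV hZ hind hZV hlaw hψm
    (fun z y => (hψ z y).trans (mul_le_of_le_one_right hc.le (S.H_le_one z y)))
    (fun z => (S.integral_sq_le ρ (hρ z) (hψ z)).trans (by
      calc c ^ 2 * (A * h) = c ^ 2 * (A * 1) * h := by ring
        _ ≤ c ^ 2 * (A * A) * h := by gcongr
        _ = _ := by ring)) hN hL (by positivity) (by
      calc 4 * L * c ^ 2 ≤ N * h * c ^ 2 := by gcongr
        _ = N * (c ^ 2 * 1 * h) := by ring
        _ ≤ N * (c ^ 2 * A ^ 2 * h) := by gcongr; nlinarith)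
  have h2 : 4 * Real.sqrt (c ^ 2 * A ^ 2 * h * L / N) = 4 * A * c * Real.sqrt (h * L / N) := by
    rw [show c ^ 2 * A ^ 2 * h * L / N = (c * A) ^ 2 * (h * L / N) by ring,
      Real.sqrt_mul (by positivity), Real.sqrt_sq (by positivity)]
    ring
  rwa [h2] at h1

/-- Variance analysis for a scaled kernel: uniform deviation of the empirical landmark operator. -/
theorem measure_not_forall_ratio_le [IsFiniteMeasure μ] [IsFiniteMeasure ν] {n m : ℕ}
    (hm : 0 < m) (hmn : m ≤ n) {X : Fin n → Ω → M} {Y : Fin m → Ω → M}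
    (hX : ∀ i, Measurable (X i)) (hY : ∀ l, Measurable (Y l))
    (hXind : iIndepFun X P) (hYind : iIndepFun Y P)
    (hXY : ∀ i, IndepFun (X i) (fun s l => Y l s) P)
    (hYX : ∀ l, IndepFun (Y l) (fun s i => X i s) P)
    (hXlaw : ∀ i, P.map (X i) = μ) (hYlaw : ∀ l, P.map (Y l) = ν)
    {L : ℝ} (hL : 0 ≤ L) (hLm : 4 * L ≤ m * h)
    (hLh : 48 * A ^ 4 * Real.sqrt (h * L / m) ≤ a ^ 2 * h) :
    P {s | ¬ ∀ i, 0 < ∑ j, ∑ l, k (X i s) (Y l s) * k (Y l s) (X j s) ∧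
      |(∑ j, (∑ l, k (X i s) (Y l s) * k (Y l s) (X j s)) * f (X j s)) /
          (∑ j, ∑ l, k (X i s) (Y l s) * k (Y l s) (X j s)) -
        f (X i s) - (∫ y, landmarkOsc μ k f (X i s) y ∂ν) /
          ∫ y, k (X i s) y * massMean μ k y ∂ν| ≤
      (96 * A ^ 4 / a ^ 2 + 96 * A ^ 8 / a ^ 4) * (b * (Real.sqrt (h * L / m) / h))} ≤
    ENNReal.ofReal (10 * n * Real.exp (-(3 * L))) := by
  have hA := S.A_pos
  have hb := S.b_pos
  have hh := S.h_pos
  have hn : 0 < n := hm.trans_le hmn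
  have hm' : (0 : ℝ) < m := by exact_mod_cast hm
  have hmn' : (m : ℝ) ≤ n := by exact_mod_cast hmn
  set θ := Real.sqrt (h * L / m) with hθ
  have hθn : Real.sqrt (h * L / n) ≤ θ := by
    apply Real.sqrt_le_sqrt
    gcongr
  have hLn : 4 * L ≤ n * h := hLm.trans (by gcongr)
  set p := ENNReal.ofReal (2 * Real.exp (-(3 * L))) with hp
  set B₁ : Fin m → Set Ω := fun l => {s | 4 * A ^ 2 * b * θ <
    |(∑ j, k (Y l s) (X j s) * (f (X j s) - f (Y l s))) / n - oscMean μ k f (Y l s)|} with hB₁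
  set B₂ : Fin m → Set Ω := fun l => {s | 4 * A ^ 2 * θ <
    |(∑ j, k (Y l s) (X j s)) / n - massMean μ k (Y l s)|} with hB₂
  set B₃ : Fin n → Set Ω := fun i => {s | 4 * A * θ <
    |(∑ l, H (X i s) (Y l s)) / m - ∫ y, H (X i s) y ∂ν|} with hB₃
  set B₄ : Fin n → Set Ω := fun i => {s | 8 * A ^ 4 * b * h * θ <
    |(∑ l, landmarkOsc μ k f (X i s) (Y l s)) / m - ∫ y, landmarkOsc μ k f (X i s) y ∂ν|} with hB₄
  set B₅ : Fin n → Set Ω := fun i => {s | 4 * A ^ 4 * h * θ <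
    |(∑ l, k (X i s) (Y l s) * massMean μ k (Y l s)) / m -
      ∫ y, k (X i s) y * massMean μ k y ∂ν|} with hB₅
  have h₁ : ∀ l, P (B₁ l) ≤ p := fun l => by
    refine (measure_mono fun s hs => ?_).trans (S.measure_abs_average_sub_gt_le
      S.integral_H_left hX (hY l) hXind (hYX l) hXlaw S.meas_osc (c := A * b) (by positivity)
      S.abs_osc hn hL hLn)
    refine lt_of_le_of_lt ?_ (show 4 * A ^ 2 * b * θ < _ from hs)
    calc _ ≤ 4 * A * (A * b) * θ := by gcongr
      _ = _ := by ring
  have h₂ : ∀ l, P (B₂ l) ≤ p := fun l => by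
    refine (measure_mono fun s hs => ?_).trans (S.measure_abs_average_sub_gt_le
      S.integral_H_left hX (hY l) hXind (hYX l) hXlaw S.meas_k (c := A) (by positivity)
      S.abs_k hn hL hLn)
    refine lt_of_le_of_lt ?_ (show 4 * A ^ 2 * θ < _ from hs)
    calc _ ≤ 4 * A * A * θ := by gcongr
      _ = _ := by ring
  have h₃ : ∀ i, P (B₃ i) ≤ p := fun i => by
    refine (measure_mono fun s hs => ?_).trans (S.measure_abs_average_sub_gt_le
      S.integral_H_right hY (hX i) hYind (hXY i) hYlaw S.meas_H (c := 1) one_pos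
      (fun x y => by rw [one_mul, abs_of_nonneg (S.H_nonneg x y)]) hm hL hLm)
    refine lt_of_le_of_lt (le_of_eq ?_) (show 4 * A * θ < _ from hs)
    ring
  have h₄ : ∀ i, P (B₄ i) ≤ p := fun i => by
    refine (measure_mono fun s hs => ?_).trans (S.measure_abs_average_sub_gt_le
      S.integral_H_right hY (hX i) hYind (hXY i) hYlaw S.measurable_landmarkOsc
      (c := 2 * A ^ 3 * b * h) (by positivity) S.abs_landmarkOsc_le hm hL hLm)
    refine lt_of_le_of_lt (le_of_eq ?_) (show 8 * A ^ 4 * b * h * θ < _ from hs)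
    ring
  have h₅ : ∀ i, P (B₅ i) ≤ p := fun i => by
    refine (measure_mono fun s hs => ?_).trans (S.measure_abs_average_sub_gt_le
      S.integral_H_right hY (hX i) hYind (hXY i) hYlaw S.measurable_mul_massMean
      (c := A ^ 3 * h) (by positivity) S.abs_mul_massMean_le hm hL hLm)
    refine lt_of_le_of_lt (le_of_eq ?_) (show 4 * A ^ 4 * h * θ < _ from hs)
    ring
  -- Families indexed by landmarks have m ≤ n members, so each of the five families costs at most
  -- np.
  have hunion : ∀ {q : ℕ} (B : Fin q → Set Ω), q ≤ n → (∀ i, P (B i) ≤ p) →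
      P (⋃ i, B i) ≤ n * p := fun {q} B hq hBp => by
    calc P (⋃ i, B i) ≤ ∑ i, P (B i) := measure_iUnion_fintype_le _ _
      _ ≤ ∑ _i : Fin q, p := Finset.sum_le_sum fun i _ => hBp i
      _ = q * p := by simp
      _ ≤ n * p := by gcongr
  have hsub : {s | ¬ ∀ i, 0 < ∑ j, ∑ l, k (X i s) (Y l s) * k (Y l s) (X j s) ∧
      |(∑ j, (∑ l, k (X i s) (Y l s) * k (Y l s) (X j s)) * f (X j s)) /
          (∑ j, ∑ l, k (X i s) (Y l s) * k (Y l s) (X j s)) -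
        f (X i s) - (∫ y, landmarkOsc μ k f (X i s) y ∂ν) /
          ∫ y, k (X i s) y * massMean μ k y ∂ν| ≤
      (96 * A ^ 4 / a ^ 2 + 96 * A ^ 8 / a ^ 4) * (b * (θ / h))} ⊆
      ((((⋃ l, B₁ l) ∪ ⋃ l, B₂ l) ∪ ⋃ i, B₃ i) ∪ ⋃ i, B₄ i) ∪ ⋃ i, B₅ i := by
    intro s hs
    by_contra hcon
    simp only [Set.mem_union, Set.mem_iUnion, not_or, not_exists, hB₁, hB₂, hB₃, hB₄, hB₅,
      Set.mem_ofPred_eq, not_lt] at hcon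
    obtain ⟨⟨⟨⟨g₁, g₂⟩, g₃⟩, g₄⟩, g₅⟩ := hcon
    exact hs fun i => S.abs_ratio_sub_le hn hm (fun j => X j s) (fun l => Y l s) (X i s)
      (Real.sqrt_nonneg _) g₁ g₂ (g₃ i) (g₄ i) (g₅ i) hLh
  calc _ ≤ P (((((⋃ l, B₁ l) ∪ ⋃ l, B₂ l) ∪ ⋃ i, B₃ i) ∪ ⋃ i, B₄ i) ∪ ⋃ i, B₅ i) :=
        measure_mono hsub
    _ ≤ n * p + n * p + n * p + n * p + n * p := by
        refine (measure_union_le _ _).trans (add_le_add ?_ (hunion B₅ le_rfl h₅))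
        refine (measure_union_le _ _).trans (add_le_add ?_ (hunion B₄ le_rfl h₄))
        refine (measure_union_le _ _).trans (add_le_add ?_ (hunion B₃ le_rfl h₃))
        exact (measure_union_le _ _).trans (add_le_add (hunion B₁ hmn h₁) (hunion B₂ hmn h₂))
    _ = ENNReal.ofReal (10 * n * Real.exp (-(3 * L))) := by
        rw [hp, ← ENNReal.ofReal_natCast, ← ENNReal.ofReal_mul (by positivity),
          ← ENNReal.ofReal_add (by positivity) (by positivity),
          ← ENNReal.ofReal_add (by positivity) (by positivity),
          ← ENNReal.ofReal_add (by positivity) (by positivity),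
          ← ENNReal.ofReal_add (by positivity) (by positivity)]
        congr 1
        ring

theorem integral_integral_mul_swap [IsFiniteMeasure μ] [IsFiniteMeasure ν] {F : M → ℝ}
    (hF : Measurable F) {B : ℝ} (hB : ∀ x, |F x| ≤ B) (z : M) :
    ∫ x, (∫ y, k z y * k y x ∂ν) * F x ∂μ = ∫ y, k z y * ∫ x, k y x * F x ∂μ ∂ν := by
  have hA := S.A_pos
  have hB0 : 0 ≤ B := (abs_nonneg _).trans (hB z)
  have hkA : ∀ x y, |k x y| ≤ A := fun x y =>
    (S.abs_k x y).trans (mul_le_of_le_one_right hA.le (S.H_le_one x y))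
  have hmeas : Measurable (Function.uncurry fun x y => k z y * k y x * F x) :=
    ((S.meas_k.comp (measurable_const.prodMk measurable_snd)).mul
      (S.meas_k.comp (measurable_snd.prodMk measurable_fst))).mul (hF.comp measurable_fst)
  have hint : Integrable (Function.uncurry fun x y => k z y * k y x * F x) (μ.prod ν) := by
    refine Integrable.of_bound hmeas.aestronglyMeasurable (A * A * B)
      (Eventually.of_forall fun p => ?_)
    rw [Function.uncurry, Real.norm_eq_abs, abs_mul, abs_mul]
    gcongr
    · exact hkA _ _
    · exact hkA _ _
    · exact hB _
  calc _ = ∫ x, ∫ y, k z y * k y x * F x ∂ν ∂μ := by simp_rw [integral_mul_const]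
    _ = ∫ y, ∫ x, k z y * k y x * F x ∂μ ∂ν := integral_integral_swap hint
    _ = _ := by simp_rw [mul_assoc, integral_const_mul]

/-- The limiting operator in terms of `landmarkOsc` and `massMean`. -/
theorem integral_ratio_sub_eq [IsFiniteMeasure μ] [IsFiniteMeasure ν]
    {B : ℝ} (hB : ∀ x, |f x| ≤ B) (z : M) :
    (∫ x, (∫ y, k z y * k y x ∂ν) * f x ∂μ) / (∫ x, (∫ y, k z y * k y x ∂ν) ∂μ) - f z =
      (∫ y, landmarkOsc μ k f z y ∂ν) / ∫ y, k z y * massMean μ k y ∂ν := by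
  have hQ : ∫ x, (∫ y, k z y * k y x ∂ν) ∂μ = ∫ y, k z y * massMean μ k y ∂ν := by
    have := S.integral_integral_mul_swap (F := fun _ => 1) measurable_const (B := 1) (by simp) z
    simp only [mul_one] at this
    exact this
  have hQpos : 0 < ∫ y, k z y * massMean μ k y ∂ν :=
    lt_of_lt_of_le (by have := S.a_pos; have := S.h_pos; positivity)
      (S.le_integral_mul_massMean z)
  have hinner : ∀ y, ∫ x, k y x * f x ∂μ = oscMean μ k f y + f y * massMean μ k y := fun y => by
    rw [oscMean, massMean, ← integral_const_mul,
      ← integral_add (S.integrable_osc μ y) ((S.integrable_k μ y).const_mul _)]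
    exact integral_congr_ae (Eventually.of_forall fun x => by ring)
  have hlint : Integrable (landmarkOsc μ k f z) ν :=
    integrable_of_abs_le (S.measurable_landmarkOsc.of_uncurry_left) (B := 2 * A ^ 3 * b * h)
      fun y => (S.abs_landmarkOsc_le z y).trans (mul_le_of_le_one_right
        (by have := S.A_pos; have := S.h_pos; have := S.b_pos; positivity) (S.H_le_one z y))
  have hN : ∫ x, (∫ y, k z y * k y x ∂ν) * f x ∂μ =
      (∫ y, landmarkOsc μ k f z y ∂ν) + f z * ∫ y, k z y * massMean μ k y ∂ν := by
    rw [S.integral_integral_mul_swap S.meas_f hB z, ← integral_const_mul,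
      ← integral_add hlint ((S.integrable_mul_massMean ν z).const_mul _)]
    refine integral_congr_ae (Eventually.of_forall fun y => ?_)
    simp only [hinner, landmarkOsc]
    ring
  rw [hN, hQ]
  field_simp
  ring

end IsScaledKernel

/-! ### Independence of the two samples, densities -/

section Sampling

variable {Ω M : Type*} [MeasurableSpace Ω] [MeasurableSpace M] {P : Measure Ω} {X Y : ℕ → Ω → M}

theorem iIndepFun_inl (h : iIndepFun (Sum.elim X Y) P) (n : ℕ) :
    iIndepFun (fun i : Fin n => X i) P :=
  h.precomp (g := fun i : Fin n => Sum.inl (i : ℕ))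
    (Sum.inl_injective.comp Fin.val_injective)

theorem indepFun_inl_inr (h : iIndepFun (Sum.elim X Y) P) (hX : ∀ i, Measurable (X i))
    (hY : ∀ i, Measurable (Y i)) (i m : ℕ) :
    IndepFun (X i) (fun s (l : Fin m) => Y l s) P := by
  have h1 := h.indepFun_finset {Sum.inl i} ((Finset.range m).map Function.Embedding.inr)
    (by simp) (by rintro (j | j); exacts [hX j, hY j])
  have hφ : Measurable fun w : (({Sum.inl i} : Finset (ℕ ⊕ ℕ)) → M) => w ⟨Sum.inl i, by simp⟩ :=
    measurable_pi_apply (X := fun _ => M) _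
  have hψ : Measurable
      fun (w : (((Finset.range m).map Function.Embedding.inr : Finset (ℕ ⊕ ℕ)) → M))
        (l : Fin m) => w ⟨Sum.inr (l : ℕ), by simp⟩ :=
    measurable_pi_lambda _ fun l => measurable_pi_apply (X := fun _ => M) _
  exact h1.comp hφ hψ

theorem iIndepFun_swap (h : iIndepFun (Sum.elim X Y) P) : iIndepFun (Sum.elim Y X) P := by
  have h1 := h.precomp (g := Sum.swap) Sum.swap_leftInverse.injective
  convert h1 using 1
  ext i
  cases i <;> rfl

end Sampling

theorem exists_bounds_of_pos {M : Type*} [TopologicalSpace M] [CompactSpace M] {p : M → ℝ}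
    (hp : Continuous p) (hpos : ∀ x, 0 < p x) :
    ∃ a A : ℝ, 0 < a ∧ 0 < A ∧ ∀ x, a ≤ p x ∧ p x ≤ A := by
  rcases isEmpty_or_nonempty M with h | h
  · exact ⟨1, 1, one_pos, one_pos, fun x => h.elim x⟩
  · obtain ⟨x₀, -, h₀⟩ := isCompact_univ.exists_isMinOn Set.univ_nonempty hp.continuousOn
    obtain ⟨x₁, -, h₁⟩ := isCompact_univ.exists_isMaxOn Set.univ_nonempty hp.continuousOn
    exact ⟨p x₀, p x₁, hpos _, hpos _, fun x => ⟨h₀ (Set.mem_univ x), h₁ (Set.mem_univ x)⟩⟩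

section Density

variable {M : Type*} [MeasurableSpace M] {V : Measure M} {p : M → ℝ} {a A : ℝ}

theorem withDensity_apply_le (hA : ∀ x, p x ≤ A) {B : Set M} (hB : MeasurableSet B) :
    V.withDensity (fun x => ENNReal.ofReal (p x)) B ≤ ENNReal.ofReal A * V B := by
  rw [withDensity_apply _ hB, ← setLIntegral_const]
  exact lintegral_mono fun x => ENNReal.ofReal_le_ofReal (hA x)

theorem le_withDensity_apply (ha : ∀ x, a ≤ p x) {B : Set M} (hB : MeasurableSet B) :
    ENNReal.ofReal a * V B ≤ V.withDensity (fun x => ENNReal.ofReal (p x)) B := by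
  rw [withDensity_apply _ hB, ← setLIntegral_const]
  exact lintegral_mono fun x => ENNReal.ofReal_le_ofReal (ha x)

theorem integral_withDensity_ofReal (hp : Measurable p) (h0 : ∀ x, 0 ≤ p x) (φ : M → ℝ) :
    ∫ x, φ x ∂(V.withDensity fun x => ENNReal.ofReal (p x)) = ∫ x, φ x * p x ∂V := by
  rw [integral_withDensity_eq_integral_toReal_smul hp.ennreal_ofReal
    (Eventually.of_forall fun x => ENNReal.ofReal_lt_top)]
  refine integral_congr_ae (Eventually.of_forall fun x => ?_)
  simp only [smul_eq_mul, ENNReal.toReal_ofReal (h0 x), mul_comm]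

end Density

theorem kernel_comm {D : ℕ} {M : Type*} (ι : M → EuclideanSpace ℝ (Fin D)) (K : ℝ → ℝ) (ε : ℝ) (x y : M) :
    kernel ι K ε x y = kernel ι K ε y x := by
  unfold kernel
  rw [norm_sub_rev]

/-! ### The kernels K_ε are scaled kernels -/

section Kernel

variable {d D : ℕ} {M : Type*} [MeasurableSpace M] {ι : M → EuclideanSpace ℝ (Fin D)} {K : ℝ → ℝ}

/-- K is regular only on [0, ∞), so it is replaced by K(max t 0), which is continuous on ℝ and has
the same values at distances. -/
theorem IsKernel.measurable_kernel (hK : IsKernel d K) (hι : Measurable ι) (ε : ℝ) :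
    Measurable (Function.uncurry (kernel ι K ε)) := by
  have hKc : Continuous fun t : ℝ => K (max t 0) :=
    hK.contDiffOn.continuousOn.comp_continuous (continuous_id.max continuous_const)
      fun t => Set.mem_Ici.2 (le_max_right _ _)
  have h1 : Measurable fun q : M × M => ‖ι q.1 - ι q.2‖ / Real.sqrt ε := by fun_prop
  convert hKc.measurable.comp h1 using 1
  ext q
  have : 0 ≤ ‖ι q.1 - ι q.2‖ / Real.sqrt ε := by positivity
  simp [Function.uncurry, kernel, max_eq_left this]

/-- The kernels `K_ε` satisfy `IsScaledKernel` with constants independent of `ε`. -/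
theorem IsKernel.exists_isScaledKernel (hK : IsKernel d K) (hι : Measurable ι) {μ ν : Measure M}
    [IsFiniteMeasure μ] [IsFiniteMeasure ν] {C₁ c₁ r₀ : ℝ} (hC₁ : 0 < C₁) (hc₁ : 0 < c₁)
    (hr₀ : 0 < r₀)
    (hμ : ∀ (x : M) (r : ℝ), 0 < r → μ {y | ‖ι x - ι y‖ < r} ≤ ENNReal.ofReal (C₁ * r ^ d))
    (hν : ∀ (x : M) (r : ℝ), 0 < r → ν {y | ‖ι x - ι y‖ < r} ≤ ENNReal.ofReal (C₁ * r ^ d))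
    (hμ' : ∀ (x : M) (r : ℝ), 0 < r → r ≤ r₀ →
      ENNReal.ofReal (c₁ * r ^ d) ≤ μ {y | ‖ι x - ι y‖ < r})
    (hν' : ∀ (x : M) (r : ℝ), 0 < r → r ≤ r₀ →
      ENNReal.ofReal (c₁ * r ^ d) ≤ ν {y | ‖ι x - ι y‖ < r})
    {f : M → ℝ} (hf : Measurable f) {F : ℝ} (hF : ∀ x, |f x| ≤ F)
    (hlip : d = 1 → ∃ C : ℝ, 0 ≤ C ∧ ∀ x y : M, |f x - f y| ≤ C * ‖ι x - ι y‖) :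
    ∃ A a ε₀ : ℝ, 1 ≤ A ∧ 0 < a ∧ 0 < ε₀ ∧ ∀ ε : ℝ, 0 < ε → ε ≤ ε₀ →
      ∃ H : M → M → ℝ, IsScaledKernel μ ν (kernel ι K ε) H f A a
        (if d = 1 then Real.sqrt ε else 1) (Real.sqrt ε ^ d) := by
  obtain ⟨A₀, c, hA₀, hc, hKexp⟩ := hK.exists_exp_bound
  obtain ⟨C', hC', hHint⟩ := exists_integral_exp_le (M := M) (d := d) hC₁ hc hι
  obtain ⟨a, s₀, ha, hs₀, hlow⟩ := hK.exists_le_integral (M := M) hc₁ hr₀ hι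
  obtain ⟨R, hR⟩ : ∃ R : ℝ, d = 1 → ∀ x y : M, |f x - f y| ≤ R * ‖ι x - ι y‖ := by
    by_cases h : d = 1
    · obtain ⟨C, -, hC⟩ := hlip h
      exact ⟨C, fun _ => hC⟩
    · exact ⟨0, fun h' => absurd h' h⟩
  set A := max 1 (max A₀ (max (A₀ * |R|) (max (A₀ * (2 * F)) C'))) with hA
  have hA1 : 1 ≤ A := le_max_left _ _
  have hAA₀ : A₀ ≤ A := (le_max_left _ _).trans (le_max_right _ _)
  have hAR : A₀ * |R| ≤ A :=
    (le_max_left _ _).trans ((le_max_right _ _).trans (le_max_right _ _))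
  have hAF : A₀ * (2 * F) ≤ A := (le_max_left _ _).trans
    ((le_max_right _ _).trans ((le_max_right _ _).trans (le_max_right _ _)))
  have hAC : C' ≤ A := (le_max_right _ _).trans
    ((le_max_right _ _).trans ((le_max_right _ _).trans (le_max_right _ _)))
  refine ⟨A, a, s₀ ^ 2, hA1, ha, by positivity, fun ε hε hεs => ?_⟩
  set s := Real.sqrt ε with hs
  have hspos : 0 < s := Real.sqrt_pos.2 hε
  have hss₀ : s ≤ s₀ := (Real.sqrt_le_left hs₀.le).2 hεs
  have ht : ∀ x y : M, 0 ≤ ‖ι x - ι y‖ / s := fun x y => by positivity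
  have hkm := hK.measurable_kernel hι ε
  have hkint : ∀ (ρ : Measure M) [IsFiniteMeasure ρ] (x : M),
      Integrable (fun y => K (‖ι x - ι y‖ / s)) ρ := fun ρ _ x => by
    refine integrable_of_abs_le (hkm.of_uncurry_left (x := x)) (B := A₀) fun y => ?_
    rw [abs_of_nonneg (hK.nonneg _ (ht x y))]
    refine (hKexp _ (ht x y)).1.trans (mul_le_of_le_one_right hA₀.le ?_)
    rw [Real.exp_le_one_iff]
    have := ht x y
    have : 0 ≤ c * (‖ι x - ι y‖ / s) := by positivity
    linarith
  refine ⟨fun x y => Real.exp (-(c * (‖ι x - ι y‖ / s))), ?_⟩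
  exact
    { meas_k := hkm
      meas_H := by
        have h1 : Measurable fun q : M × M => Real.exp (-(c * (‖ι q.1 - ι q.2‖ / s))) := by
          fun_prop
        exact h1
      meas_f := hf
      symm := kernel_comm ι K ε
      nonneg := fun x y => hK.nonneg _ (ht x y)
      le_mul := fun x y => (hKexp _ (ht x y)).1.trans (by gcongr)
      osc_le := fun x y => by
        set E := Real.exp (-(c * (‖ι x - ι y‖ / s))) with hE
        have hk0 : 0 ≤ kernel ι K ε x y := hK.nonneg _ (ht x y)
        have hE0 : 0 < E := Real.exp_pos _
        -- For d = 1 the Lipschitz bound reads |R| s t with t the rescaled distance, and tK(t) still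
        -- decays exponentially: this gains b = s. Otherwise the bound 2F on the oscillation gives b
        -- = 1.
        split_ifs with h
        · have h1 : |f y - f x| ≤ |R| * (s * (‖ι x - ι y‖ / s)) := by
            rw [abs_sub_comm, mul_div_cancel₀ _ hspos.ne']
            exact (hR h x y).trans (by gcongr; exact le_abs_self R)
          calc _ ≤ kernel ι K ε x y * (|R| * (s * (‖ι x - ι y‖ / s))) := by gcongr
            _ = |R| * s * (K (‖ι x - ι y‖ / s) * (‖ι x - ι y‖ / s)) := by
              unfold kernel; ring
            _ ≤ |R| * s * (A₀ * E) :=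
              mul_le_mul_of_nonneg_left (hKexp _ (ht x y)).2 (by positivity)
            _ = A₀ * |R| * s * E := by ring
            _ ≤ _ := by gcongr
        · have h1 : |f y - f x| ≤ 2 * F := by
            have h2 := abs_sub (f y) (f x)
            have h3 := hF x
            have h4 := hF y
            linarith
          have hF0 : 0 ≤ F := (abs_nonneg _).trans (hF x)
          calc _ ≤ (A₀ * E) * (2 * F) := by
                gcongr
                exact (hKexp _ (ht x y)).1
            _ = A₀ * (2 * F) * 1 * E := by ring
            _ ≤ _ := by gcongr
      H_nonneg := fun x y => (Real.exp_pos _).le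
      H_le_one := fun x y => by
        rw [Real.exp_le_one_iff]
        have := ht x y
        have : 0 ≤ c * (‖ι x - ι y‖ / s) := by positivity
        linarith
      integral_H_left := fun x => (hHint μ hμ s x hspos).trans (by gcongr)
      integral_H_right := fun x => (hHint ν hν s x hspos).trans (by gcongr)
      le_integral_left := fun x => hlow μ hμ' s x hspos hss₀ (hkint μ x)
      le_integral_right := fun x => hlow ν hν' s x hspos hss₀ (hkint ν x)
      one_le := hA1
      a_pos := ha
      b_pos := by split_ifs <;> simp [hspos]
      h_pos := by positivity }

end Kernel

/-! ### Matrix entries, the limiting operator and rates -/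

section Matrices

variable {D : ℕ} {M : Type*} (ι : M → EuclideanSpace ℝ (Fin D)) (K : ℝ → ℝ) (ε : ℝ) {n m : ℕ}
  (x : Fin n → M) (y : Fin m → M)

theorem affinityMatrix_apply (i j : Fin n) :
    affinityMatrix ι K ε x y i j =
      ∑ l, kernel ι K ε (x i) (y l) * kernel ι K ε (y l) (x j) := by
  simp only [affinityMatrix, landmarkSetMatrix, Matrix.mul_apply, Matrix.transpose_apply,
    Matrix.of_apply, kernel_comm ι K ε (x j)]

theorem degreeMatrix_apply_self (i : Fin n) :
    degreeMatrix ι K ε x y i i =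
      ∑ j, ∑ l, kernel ι K ε (x i) (y l) * kernel ι K ε (y l) (x j) := by
  simp only [degreeMatrix, Matrix.diagonal_apply_eq, Matrix.mulVec, dotProduct, mul_one,
    affinityMatrix_apply]

theorem one_sub_inv_degreeMatrix_mulVec (hpos : ∀ i, degreeMatrix ι K ε x y i i ≠ 0)
    (f : M → ℝ) (i : Fin n) :
    ((1 - (degreeMatrix ι K ε x y)⁻¹ * affinityMatrix ι K ε x y) *ᵥ fun j => f (x j)) i =
      f (x i) - (∑ j, (∑ l, kernel ι K ε (x i) (y l) * kernel ι K ε (y l) (x j)) * f (x j)) /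
        ∑ j, ∑ l, kernel ι K ε (x i) (y l) * kernel ι K ε (y l) (x j) := by
  have hinv : (degreeMatrix ι K ε x y)⁻¹ =
      Matrix.diagonal fun i => (degreeMatrix ι K ε x y i i)⁻¹ := by
    apply Matrix.inv_eq_left_inv
    have h1 : degreeMatrix ι K ε x y = Matrix.diagonal fun i => degreeMatrix ι K ε x y i i := by
      ext i j
      by_cases h : i = j
      · subst h; simp
      · simp [degreeMatrix, h]
    conv_lhs => rw [h1]
    rw [Matrix.diagonal_mul_diagonal, ← Matrix.diagonal_one]
    congr 1
    ext i
    simp only [Matrix.diagonal_apply_eq]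
    exact inv_mul_cancel₀ (hpos i)
  rw [hinv, Matrix.sub_mulVec, Matrix.one_mulVec, Pi.sub_apply, ← Matrix.mulVec_mulVec,
    Matrix.mulVec_diagonal, degreeMatrix_apply_self, inv_mul_eq_div]
  simp only [Matrix.mulVec, dotProduct, affinityMatrix_apply]

end Matrices

theorem refOperator_eq {D : ℕ} {M : Type*} [MeasurableSpace M] {V : Measure M}
    (ι : M → EuclideanSpace ℝ (Fin D)) (K : ℝ → ℝ) {pX pY : M → ℝ} (hpX : Measurable pX)
    (hpX0 : ∀ x, 0 ≤ pX x) (hpY : Measurable pY) (hpY0 : ∀ x, 0 ≤ pY x) (ε : ℝ) (f : M → ℝ)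
    (x : M) :
    refOperator V ι K pX pY ε f x =
      (∫ y, (∫ z, kernel ι K ε x z * kernel ι K ε z y
          ∂(V.withDensity fun z => ENNReal.ofReal (pY z))) * f y
        ∂(V.withDensity fun y => ENNReal.ofReal (pX y))) /
      ∫ y, (∫ z, kernel ι K ε x z * kernel ι K ε z y
          ∂(V.withDensity fun z => ENNReal.ofReal (pY z)))
        ∂(V.withDensity fun y => ENNReal.ofReal (pX y)) := by
  simp only [integral_withDensity_ofReal hpX hpX0, integral_withDensity_ofReal hpY hpY0]
  change refOperator V ι K pX pY ε f x =
    (∫ y, refKernel V ι K pY ε x y * f y * pX y ∂V) / refDegree V ι K pX pY ε x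
  rw [refOperator, ← integral_div]
  exact integral_congr_ae (Eventually.of_forall fun y => by ring)

theorem numLandmarks_le {β : ℝ} (hβ1 : β ≤ 1) {n : ℕ} (hn : 1 ≤ n) :
    numLandmarks β n ≤ n := by
  have hn' : (1 : ℝ) ≤ n := by exact_mod_cast hn
  have h1 : (n : ℝ) ^ β ≤ n := by
    simpa using Real.rpow_le_rpow_of_exponent_le hn' hβ1
  have h2 : round ((n : ℝ) ^ β) ≤ round (n : ℝ) := by
    rw [round_eq, round_eq]
    exact Int.floor_le_floor (by linarith)
  rw [round_natCast] at h2
  exact Int.toNat_le.2 h2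

/-- Rounding loses at most 1/2, which is at most half of n^β because n^β ≥ 1. -/
theorem rpow_le_two_mul_numLandmarks {β : ℝ} (hβ : 0 < β) {n : ℕ} (hn : 1 ≤ n) :
    (n : ℝ) ^ β ≤ 2 * numLandmarks β n := by
  have hn' : (1 : ℝ) ≤ n := by exact_mod_cast hn
  have h1 : 1 ≤ (n : ℝ) ^ β := Real.one_le_rpow hn' hβ.le
  have h2 := (abs_le.1 (abs_sub_round ((n : ℝ) ^ β))).2
  have h3 : (round ((n : ℝ) ^ β) : ℝ) ≤ numLandmarks β n := by
    have := Int.self_le_toNat (round ((n : ℝ) ^ β))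
    exact_mod_cast this
  linarith

/-- Comparison of the rate `b √(L / (m h))` with `√L / (N s^(d-1))`, where `h = s ^ d`. -/
theorem scale_mul_sqrt_div_le {d : ℕ} (hd : 1 ≤ d) {s L N m : ℝ} (hs : 0 < s) (hs1 : s ≤ 1)
    (hL : 0 ≤ L) (hN : 0 < N) (hm : N ^ 2 ≤ 4 * m) :
    (if d = 1 then s else 1) * (Real.sqrt (s ^ d * L / m) / s ^ d) ≤
      2 * (Real.sqrt L / (N * s ^ (d - 1))) ∧
    Real.sqrt (s ^ d * L / m) / s ^ d ≤ 2 * (Real.sqrt L / (N * s ^ (d + 1))) := by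
  have hm0 : 0 < m := by nlinarith [pow_pos hN 2]
  have hsd : 0 < s ^ d := pow_pos hs d
  -- Squaring and N² ≤ 4m reduce both rates to b²t² ≤ s^d. With t = s^(d-1) and b = 1 this is 2(d-1)
  -- ≥ d, that is d ≥ 2; for d = 1 it is s² ≤ s.
  have key : ∀ b t : ℝ, 0 ≤ b → 0 < t → b ^ 2 * t ^ 2 ≤ s ^ d →
      b * (Real.sqrt (s ^ d * L / m) / s ^ d) ≤ 2 * (Real.sqrt L / (N * t)) := by
    intro b t hb ht hbt
    have h1 : 0 ≤ 2 * (Real.sqrt L / (N * t)) := by positivity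
    apply le_of_sq_le_sq _ h1
    rw [mul_pow, div_pow, mul_pow, div_pow, mul_pow, Real.sq_sqrt hL,
      Real.sq_sqrt (by positivity)]
    have h2 : b ^ 2 * (s ^ d * L / m / (s ^ d) ^ 2) = b ^ 2 * L / (m * s ^ d) := by field_simp
    rw [h2, ← mul_div_assoc, div_le_div_iff₀ (by positivity) (by positivity)]
    calc b ^ 2 * L * (N ^ 2 * t ^ 2) = L * N ^ 2 * (b ^ 2 * t ^ 2) := by ring
      _ ≤ L * (4 * m) * s ^ d := by gcongr
      _ = _ := by ring
  constructor
  · apply key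
    · split_ifs <;> positivity
    · positivity
    · split_ifs with h
      · subst h; simp; nlinarith
      · rw [one_pow, one_mul, ← pow_mul]
        exact pow_le_pow_of_le_one hs.le hs1 (by omega)
  · have h1 := key 1 (s ^ (d + 1)) zero_le_one (by positivity) (by
      rw [one_pow, one_mul, ← pow_mul]
      exact pow_le_pow_of_le_one hs.le hs1 (by omega))
    rwa [one_mul] at h1

end Roseland

/-! ### The variance theorem -/

theorem theorem3p2 {d D : ℕ} (hd : 1 ≤ d)
    {M : Type*} [TopologicalSpace M] [CompactSpace M]
    [ChartedSpace (EuclideanSpace ℝ (Fin d)) M] [IsManifold (𝓡 d) ∞ M]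
    [MeasurableSpace M] [BorelSpace M]
    (g : Roseland.Metric d M) (ι : M → EuclideanSpace ℝ (Fin D))
    (hι : Roseland.IsIsometricEmbedding g ι)
    (K : ℝ → ℝ) (hK : Roseland.IsKernel d K)
    (pX pY : M → ℝ)
    (hpX : ContMDiff (𝓡 d) 𝓘(ℝ, ℝ) 4 pX) (hpX_pos : ∀ x, 0 < pX x)
    (hpY : ContMDiff (𝓡 d) 𝓘(ℝ, ℝ) 4 pY) (hpY_pos : ∀ x, 0 < pY x)
    (f : M → ℝ) (hf : Continuous f) (hf_one : d = 1 → ContMDiff (𝓡 d) 𝓘(ℝ, ℝ) 1 f) :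
    ∃ C : ℝ, 0 < C ∧
      ∀ (Ω : Type*) [MeasurableSpace Ω] (P : Measure Ω) [IsProbabilityMeasure P]
        (X Y : ℕ → Ω → M),
        (∀ i, Measurable (X i)) → (∀ k, Measurable (Y k)) →
        iIndepFun (Sum.elim X Y) P →
        (∀ i, P.map (X i) =
          (Roseland.riemannianMeasure g).withDensity fun x => ENNReal.ofReal (pX x)) →
        (∀ k, P.map (Y k) =
          (Roseland.riemannianMeasure g).withDensity fun y => ENNReal.ofReal (pY y)) →
        ∀ (β : ℝ) (ε : ℕ → ℝ), 0 < β → β ≤ 1 → (∀ n, 0 < ε n) →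
          Tendsto ε atTop (𝓝 0) →
          Tendsto (fun n : ℕ => Real.sqrt (Real.log n) /
            ((n : ℝ) ^ (β / 2) * ε n ^ ((d : ℝ) / 2 + 1 / 2))) atTop (𝓝 0) →
          ∀ᶠ n : ℕ in atTop,
            P {s | ¬ ∀ i : Fin n,
              let x : Fin n → M := fun j => X j s
              let y : Fin (Roseland.numLandmarks β n) → M := fun k => Y k s
              let W := Roseland.affinityMatrix ι K (ε n) x y
              let Deg := Roseland.degreeMatrix ι K (ε n) x y
              0 < Deg i i ∧
              |((1 - Deg⁻¹ * W) *ᵥ fun j => f (x j)) i -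
                  (f (x i) - Roseland.refOperator (Roseland.riemannianMeasure g) ι K pX pY
                    (ε n) f (x i))| ≤
                C * (Real.sqrt (Real.log n) /
                  ((n : ℝ) ^ (β / 2) * ε n ^ ((d : ℝ) / 2 - 1 / 2)))} ≤
              ENNReal.ofReal (C / (n : ℝ) ^ 2) := by
  set V := Roseland.riemannianMeasure g with hV
  have hVfin : IsFiniteMeasure V := Roseland.isFiniteMeasure_riemannianMeasure hι
  have hιm : Measurable ι := hι.isEmbedding.continuous.measurable
  obtain ⟨C₁, hC₁, hball⟩ := Roseland.exists_riemannianMeasure_ball_le hι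
  obtain ⟨c₁, r₀, hc₁, hr₀, hball'⟩ := Roseland.exists_le_riemannianMeasure_ball hι
  obtain ⟨aX, AX, haX, hAX, hbX⟩ := Roseland.exists_bounds_of_pos hpX.continuous hpX_pos
  obtain ⟨aY, AY, haY, hAY, hbY⟩ := Roseland.exists_bounds_of_pos hpY.continuous hpY_pos
  have hBm : ∀ (x : M) (r : ℝ), MeasurableSet {y | ‖ι x - ι y‖ < r} := fun x r =>
    (Roseland.isOpen_extrinsicBall hι x r).measurableSet
  have hup : ∀ (p : M → ℝ) (A : ℝ), 0 < A → A ≤ max AX AY → (∀ x, p x ≤ A) →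
      ∀ (x : M) (r : ℝ), 0 < r → V.withDensity (fun x => ENNReal.ofReal (p x))
        {y | ‖ι x - ι y‖ < r} ≤ ENNReal.ofReal (max AX AY * C₁ * r ^ d) := by
    intro p A hA hAle hp x r hr
    refine (Roseland.withDensity_apply_le hp (hBm x r)).trans ?_
    rw [mul_assoc, ENNReal.ofReal_mul (hA.le.trans hAle)]
    exact mul_le_mul' (ENNReal.ofReal_le_ofReal hAle) (hball x r hr)
  have hdown : ∀ (p : M → ℝ) (a : ℝ), 0 < a → min aX aY ≤ a → (∀ x, a ≤ p x) →
      ∀ (x : M) (r : ℝ), 0 < r → r ≤ r₀ → ENNReal.ofReal (min aX aY * c₁ * r ^ d) ≤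
        V.withDensity (fun x => ENNReal.ofReal (p x)) {y | ‖ι x - ι y‖ < r} := by
    intro p a ha hale hp x r hr hrr
    refine le_trans ?_ (Roseland.le_withDensity_apply hp (hBm x r))
    rw [mul_assoc, ENNReal.ofReal_mul (lt_min haX haY).le]
    exact mul_le_mul' (ENNReal.ofReal_le_ofReal hale) (hball' x r hr hrr)
  have hfinite : ∀ (p : M → ℝ) (A : ℝ), (∀ x, p x ≤ A) →
      IsFiniteMeasure (V.withDensity fun x => ENNReal.ofReal (p x)) := fun p A hp =>
    ⟨(Roseland.withDensity_apply_le hp MeasurableSet.univ).trans_lt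
      (ENNReal.mul_lt_top ENNReal.ofReal_lt_top (measure_lt_top _ _))⟩
  set μ := V.withDensity fun x => ENNReal.ofReal (pX x) with hμ
  set ν := V.withDensity fun x => ENNReal.ofReal (pY x) with hν
  have hμfin : IsFiniteMeasure μ := hfinite pX AX fun x => (hbX x).2
  have hνfin : IsFiniteMeasure ν := hfinite pY AY fun x => (hbY x).2
  obtain ⟨F, hF⟩ : ∃ F : ℝ, ∀ x, |f x| ≤ F := by
    obtain ⟨F, hF⟩ := (isCompact_range hf).isBounded.exists_norm_le
    exact ⟨F, fun x => hF _ ⟨x, rfl⟩⟩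
  obtain ⟨A, a, ε₀, hA1, ha, hε₀, hS⟩ := hK.exists_isScaledKernel (μ := μ) (ν := ν) hιm
    (C₁ := max AX AY * C₁) (c₁ := min aX aY * c₁) (by positivity) (by positivity) hr₀
    (hup pX AX hAX (le_max_left _ _) fun x => (hbX x).2)
    (hup pY AY hAY (le_max_right _ _) fun x => (hbY x).2)
    (hdown pX aX haX (min_le_left _ _) fun x => (hbX x).1)
    (hdown pY aY haY (min_le_right _ _) fun x => (hbY x).1) hf.measurable hF
    (fun h => Roseland.exists_lipschitz_of_contMDiff hι (hf_one h))
  set C₀ := 96 * A ^ 4 / a ^ 2 + 96 * A ^ 8 / a ^ 4 with hC₀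
  have hA0 : 0 < A := one_pos.trans_le hA1
  have hC₀pos : 0 < C₀ := by positivity
  -- The 2C₀ serves the error bound, with its 2 from `scale_mul_sqrt_div_le`; the 10 serves the
  -- probability.
  refine ⟨2 * C₀ + 10, by positivity, ?_⟩
  intro Ω _ P _ X Y hX hY hind hXlaw hYlaw β ε hβ hβ1 hε hε0 hrate
  -- As θ/h ≤ 2δ, the bound 1/4 puts the samples in the Bernstein regime 4L ≤ mh, and the other
  -- bound keeps the denominator error below half of Q.
  set δ := min (1 / 4) (a ^ 2 / (96 * A ^ 4)) with hδ
  have hδpos : 0 < δ := by positivity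
  filter_upwards [hε0.eventually (ge_mem_nhds (lt_min one_pos hε₀)),
    hrate.eventually (ge_mem_nhds hδpos), eventually_ge_atTop 1] with n hεn hηn hn
  obtain ⟨H, S⟩ := hS (ε n) (hε n) (hεn.trans (min_le_right _ _))
  set s := Real.sqrt (ε n) with hs
  have hspos : 0 < s := Real.sqrt_pos.2 (hε n)
  have hs1 : s ≤ 1 := Real.sqrt_le_one.2 (hεn.trans (min_le_left _ _))
  have hn1 : (1 : ℝ) ≤ n := by exact_mod_cast hn
  have hn0 : (0 : ℝ) < n := one_pos.trans_le hn1
  have hL : 0 ≤ Real.log n := Real.log_nonneg hn1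
  set L := Real.log n with hLdef
  set m := Roseland.numLandmarks β n with hm
  set N := (n : ℝ) ^ (β / 2) with hN
  have hNpos : 0 < N := Real.rpow_pos_of_pos hn0 _
  have hN2 : N ^ 2 = (n : ℝ) ^ β := by
    rw [hN, ← Real.rpow_natCast, ← Real.rpow_mul hn0.le]
    congr 1
    push_cast
    ring
  have hm2 : N ^ 2 ≤ 2 * m := hN2 ▸ Roseland.rpow_le_two_mul_numLandmarks hβ hn
  have hm0' : (0 : ℝ) < m := by nlinarith [pow_pos hNpos 2]
  have hm0 : 0 < m := by exact_mod_cast hm0'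
  have hmn : m ≤ n := Roseland.numLandmarks_le hβ1 hn
  have hpow : ∀ q : ℕ, ε n ^ ((q : ℝ) / 2) = s ^ q := fun q => by
    rw [hs, Real.sqrt_eq_rpow, ← Real.rpow_natCast, ← Real.rpow_mul (hε n).le]
    congr 1
    ring
  have hpow1 : ε n ^ ((d : ℝ) / 2 + 1 / 2) = s ^ (d + 1) := by
    rw [← hpow]
    congr 1
    push_cast
    ring
  have hpow2 : ε n ^ ((d : ℝ) / 2 - 1 / 2) = s ^ (d - 1) := by
    rw [← hpow, Nat.cast_sub hd]
    congr 1
    push_cast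
    ring
  rw [hpow1] at hηn
  rw [hpow2]
  obtain ⟨hsc1, hsc2⟩ := Roseland.scale_mul_sqrt_div_le hd hspos hs1 hL hNpos
    (show N ^ 2 ≤ 4 * (m : ℝ) by linarith)
  set θ := Real.sqrt (s ^ d * L / m) with hθ
  have hsd : 0 < s ^ d := pow_pos hspos d
  have hθδ : θ / s ^ d ≤ 2 * δ := hsc2.trans (by linarith)
  have hθ1 : θ ≤ s ^ d / 2 := by
    rw [div_le_iff₀ hsd] at hθδ
    have : δ ≤ 1 / 4 := min_le_left _ _
    nlinarith
  have hLm : 4 * L ≤ m * s ^ d := by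
    have h1 : θ ^ 2 = s ^ d * L / m := Real.sq_sqrt (by positivity)
    have h2 : θ ^ 2 ≤ (s ^ d / 2) ^ 2 := pow_le_pow_left₀ (Real.sqrt_nonneg _) hθ1 2
    rw [h1, div_le_iff₀ hm0'] at h2
    refine le_of_mul_le_mul_left ?_ hsd
    nlinarith
  have hLh : 48 * A ^ 4 * θ ≤ a ^ 2 * s ^ d := by
    have h1 : δ ≤ a ^ 2 / (96 * A ^ 4) := min_le_right _ _
    rw [le_div_iff₀ (by positivity)] at h1
    rw [div_le_iff₀ hsd] at hθδ
    calc 48 * A ^ 4 * θ ≤ 48 * A ^ 4 * (2 * δ * s ^ d) := by gcongr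
      _ = δ * (96 * A ^ 4) * s ^ d := by ring
      _ ≤ _ := by gcongr
  have hmain := S.measure_not_forall_ratio_le (P := P) hm0 hmn
    (X := fun i : Fin n => X i) (Y := fun l : Fin m => Y l) (fun i => hX i) (fun l => hY l)
    (Roseland.iIndepFun_inl hind n) (Roseland.iIndepFun_inl (Roseland.iIndepFun_swap hind) m)
    (fun i => Roseland.indepFun_inl_inr hind hX hY i m)
    (fun l => Roseland.indepFun_inl_inr (Roseland.iIndepFun_swap hind) hY hX l n)
    (fun i => hXlaw i) (fun l => hYlaw l) hL hLm hLh
  refine (measure_mono fun q hq => ?_).trans (hmain.trans ?_)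
  · refine fun hgood => hq fun i => ?_
    have hdeg : ∀ i, 0 < Roseland.degreeMatrix ι K (ε n) (fun j : Fin n => X j q)
        (fun l : Fin m => Y l q) i i := fun i => by
      rw [Roseland.degreeMatrix_apply_self]
      exact (hgood i).1
    refine ⟨hdeg i, ?_⟩
    rw [Roseland.one_sub_inv_degreeMatrix_mulVec ι K (ε n) _ _ (fun i => (hdeg i).ne') f i,
      Roseland.refOperator_eq ι K hpX.continuous.measurable (fun x => (hpX_pos x).le)
        hpY.continuous.measurable (fun x => (hpY_pos x).le)]
    have h1 := (hgood i).2
    rw [← S.integral_ratio_sub_eq hF] at h1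
    rw [sub_sub_sub_cancel_left, abs_sub_comm]
    rw [sub_sub_sub_cancel_right] at h1
    refine h1.trans ?_
    have h2 : 0 ≤ Real.sqrt L / (N * s ^ (d - 1)) := by positivity
    calc _ ≤ C₀ * (2 * (Real.sqrt L / (N * s ^ (d - 1)))) :=
          mul_le_mul_of_nonneg_left hsc1 hC₀pos.le
      _ = 2 * C₀ * (Real.sqrt L / (N * s ^ (d - 1))) := by ring
      _ ≤ _ := mul_le_mul_of_nonneg_right (by linarith) h2
  · apply ENNReal.ofReal_le_ofReal
    -- With L = log n the union bound 10n exp(-3L) equals 10/n².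
    have h1 : Real.exp (-(3 * L)) = ((n : ℝ) ^ 3)⁻¹ := by
      rw [Real.exp_neg, hLdef, ← Real.exp_log (pow_pos hn0 3), Real.log_pow]
      norm_num
    rw [h1, le_div_iff₀ (by positivity)]
    have h2 : 10 * (n : ℝ) * ((n : ℝ) ^ 3)⁻¹ * (n : ℝ) ^ 2 = 10 := by field_simp
    linarith
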